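/- Let $n\ge 0$, let $\Omega\subseteq\mathbb R^n$ be open, and let $Q(D)=\sum_{|\alpha|\le m}a_\alpha D^\alpha$ be a linear differential operator with constant complex coefficients, of order exactly $m\ge 1$, where $D_j=-i\,\partial/\partial x_j$, with symbol $Q(\xi)=\sum_{|\alpha|\le m}a_\alpha\xi^\alpha$. Write $Q^{(\beta)}=\partial_\xi^\beta Q$. Suppose that $Q(D)$ is $d$-hypoelliptic, that is, $d$ is the smallest real number $d\ge 1$ for which there is a constant $C>0$ with $$|\xi|^{|\beta|/d}\,|Q^{(\beta)}(\xi)|\le C\,(1+|Q(\xi)|)\qquad\text{for all }\beta\in\mathbb Z_+^n,\ \xi\in\mathbb R^n .$$ Let $(M_p)_{p\ge 0}$ be a sequence of positive real numbers such that - $M_0=1$ and $M_p^2\le M_{p-1}M_{p+1}$ for all $p\ge 1$; - there is $H>0$ such that $\binom pj M_{p-j}M_j\le M_p\le H^pM_{p-j}M_j$ for all $p\ge 0$ and $0\le j\le p$; - there are $L>0$ and $C>0$ such that $(p!)^d\le C\,L^p M_p$ for all $p\ge 0$. Let $u\in C^\infty(\Omega)$ be a complex-valued function such that for every compact $K\subset\Omega$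 there is $C>0$ with $$\|Q(D)^l u\|_{L^2(K)}\le C^{\,l+1}M_{lm}\qquad\text{for all } l\ge 0$$ (a Roumieu vector of $Q(D)$ in $\Omega$). Then for every compact $K\subset\Omega$ there is $C>0$ with $$\|D^\alpha u\|_{L^2(K)}\le C^{\,|\alpha|+1}\,(M_{|\alpha|})^{d}\qquad\text{for all }\alpha\in\mathbb Z_+^n .$$ In other words, $R_M(\Omega,Q)\subset R_{M^d}(\Omega)$, where $M^d=(M_p^{\,d})_p$. -/

import Mathlib

open MeasureTheory
open scoped ContDiff

noncomputable section

/-- The partial differential operator `D_j = -i ∂_j`, acting on complex-valued functions on `ℝⁿ`.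
The normalization is the one for which the operator `Q(D)` has the symbol `Q(ξ)`. -/
def partialD {n : ℕ} (j : Fin n) (u : EuclideanSpace ℝ (Fin n) → ℂ) :
    EuclideanSpace ℝ (Fin n) → ℂ :=
  fun x => -Complex.I * fderiv ℝ u x (EuclideanSpace.single j 1)

/-- The operator `D^α = D_1^{α_1} ⋯ D_n^{α_n}`. -/
def multiD {n : ℕ} (α : Fin n →₀ ℕ) (u : EuclideanSpace ℝ (Fin n) → ℂ) :
    EuclideanSpace ℝ (Fin n) → ℂ :=
  (List.finRange n).foldr (fun j v => (partialD j)^[α j] v) u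

/-- The constant coefficient operator `Q(D) = ∑ a_α D^α` attached to the polynomial
`Q = ∑ a_α ξ^α`. Its order is the total degree of `Q`. -/
def constCoeffOp {n : ℕ} (Q : MvPolynomial (Fin n) ℂ) (u : EuclideanSpace ℝ (Fin n) → ℂ) :
    EuclideanSpace ℝ (Fin n) → ℂ :=
  fun x => ∑ α ∈ Q.support, Q.coeff α * multiD α u x

/-- The symbol `Q(ξ)` at a real point `ξ`. -/
def symbolAt {n : ℕ} (Q : MvPolynomial (Fin n) ℂ) (ξ : EuclideanSpace ℝ (Fin n)) : ℂ :=
  MvPolynomial.eval (fun j => ((ξ j : ℝ) : ℂ)) Q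

/-- The derivative `Q^{(β)} = ∂_ξ^β Q` of the symbol. -/
def symbolDeriv {n : ℕ} (β : Fin n →₀ ℕ) (Q : MvPolynomial (Fin n) ℂ) :
    MvPolynomial (Fin n) ℂ :=
  (List.finRange n).foldr (fun j P => (fun R => MvPolynomial.pderiv j R)^[β j] P) Q

/-- `|ξ|^{|β|/d} |Q^{(β)}(ξ)| ≤ C (1 + |Q(ξ)|)` for all `β` and all real `ξ`, for some `C > 0`. -/
def HypoellipticEstimate {n : ℕ} (Q : MvPolynomial (Fin n) ℂ) (d : ℝ) : Prop :=
  ∃ C : ℝ, 0 < C ∧ ∀ (β : Fin n →₀ ℕ) (ξ : EuclideanSpace ℝ (Fin n)),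
    ‖ξ‖ ^ ((β.degree : ℝ) / d) * ‖symbolAt (symbolDeriv β Q) ξ‖ ≤ C * (1 + ‖symbolAt Q ξ‖)

/-- `Q(D)` is `d`-hypoelliptic: `d` is the smallest number `≥ 1` for which the hypoellipticity
estimate holds. -/
def IsDHypoelliptic {n : ℕ} (Q : MvPolynomial (Fin n) ℂ) (d : ℝ) : Prop :=
  IsLeast {e : ℝ | 1 ≤ e ∧ HypoellipticEstimate Q e} d

/-- Logarithmic convexity, with the normalization `M_0 = 1`. -/
def LogConvexSeq (M : ℕ → ℝ) : Prop :=
  M 0 = 1 ∧ ∀ p : ℕ, 1 ≤ p → M p ^ 2 ≤ M (p - 1) * M (p + 1)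

/-- Stability under derivation and multiplication. -/
def StableSeq (M : ℕ → ℝ) : Prop :=
  ∃ H : ℝ, 0 < H ∧ ∀ p j : ℕ, j ≤ p →
    (p.choose j : ℝ) * M (p - j) * M j ≤ M p ∧ M p ≤ H ^ p * M (p - j) * M j

/-- The relation `M_p ⊂ N_p` between sequences. -/
def SeqSubordinate (M N : ℕ → ℝ) : Prop :=
  ∃ L : ℝ, 0 < L ∧ ∃ C : ℝ, 0 < C ∧ ∀ p : ℕ, M p ≤ C * L ^ p * N p

/-- The space `R_M(Ω, Q)` of Roumieu vectors of `Q(D)` in `Ω`. A function on `Ω` is represented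
by any of its extensions to `ℝⁿ`; only the values in `Ω` matter. -/
def RoumieuVectors {n : ℕ} (M : ℕ → ℝ) (Ω : Set (EuclideanSpace ℝ (Fin n)))
    (Q : MvPolynomial (Fin n) ℂ) : Set (EuclideanSpace ℝ (Fin n) → ℂ) :=
  {u | ContDiffOn ℝ ∞ u Ω ∧
    ∀ K : Set (EuclideanSpace ℝ (Fin n)), IsCompact K → K ⊆ Ω →
      ∃ C : ℝ, 0 < C ∧ ∀ l : ℕ,
        eLpNorm ((constCoeffOp Q)^[l] u) 2 (volume.restrict K) ≤
          ENNReal.ofReal (C ^ (l + 1) * M (l * Q.totalDegree))}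

/-- The Roumieu space `R_M(Ω)`. -/
def RoumieuSpace {n : ℕ} (M : ℕ → ℝ) (Ω : Set (EuclideanSpace ℝ (Fin n))) :
    Set (EuclideanSpace ℝ (Fin n) → ℂ) :=
  {u | ContDiffOn ℝ ∞ u Ω ∧
    ∀ K : Set (EuclideanSpace ℝ (Fin n)), IsCompact K → K ⊆ Ω →
      ∃ C : ℝ, 0 < C ∧ ∀ α : Fin n →₀ ℕ,
        eLpNorm (multiD α u) 2 (volume.restrict K) ≤
          ENNReal.ofReal (C ^ (α.degree + 1) * M α.degree)}

end

/-! Everything is local, so near a point `u` may be replaced by a Schwartz function `w`, on which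
polynomials in `D` act as Fourier multipliers. Write `m` for the order of `Q` and `s = d m`. Applied
to a multi-index of top degree, the hypoellipticity estimate gives `|ξ|^(m/d) ≤ C (1 + |Q(ξ)|)`.
Hence, by Plancherel, derivatives of order at most `l m / d` of a cut-off function `φ w` are
controlled by `Q(D)^l (φ w)` and `φ w` (`HypoellipticEstimate.exists_monomial_le`,
`l2On_univ_polyOp_le`).

The Leibniz formula expands `Q(D)^l (φ w)` into at most `S^l` products of a derivative of `φ` and a
word of length `l` in the operators `Q^(β)(D)/β!`, where `S` is the number of Taylor coefficients of
`Q`. One cutoff serves all of them if its first `l m` derivatives grow geometrically, like `(const ·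
t)^j` with `t = κ l` (`exists_cutoff`). The words are handled by the interior estimate `t^|β|
‖Q^(β)(D) w‖ ≤ C (‖Q(D) w‖ + t^s ‖w‖)`, in which the right side lives on a cube larger by `2/t` and
`C` does not depend on `t` (`HypoellipticEstimate.exists_interior`). Applying it `l` times costs a
factor `(2C)^l` and a total enlargement `2l/t = 2/κ`, independent of `l` (`l2On_hasse_prod_le`).

The outcome, `HypoellipticEstimate.exists_derivative_le`, bounds the derivatives by `A^l` times the
largest of `t^(s(l-i)) ‖Q(D)^i w‖`, `i ≤ l`. The growth condition on `M` turns `l^(s(l-i))` into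
`M_(m(l-i))` up to geometric factors, so all terms are of size `M_(lm)` (`exists_rpow_mul_le`).
Choosing `l m` just above `d |α|` and comparing `M_(lm)` with `M_|α|^d` (`exists_le_rpow_of_le`)
finishes the local estimate, and compactness globalizes it. -/

/-! ### Weight sequences -/

lemma StableSeq.mul_le {M : ℕ → ℝ} (hMpos : ∀ p, 0 < M p) (hM : StableSeq M) (p q : ℕ) :
    M p * M q ≤ M (p + q) := by
  obtain ⟨H, -, hH⟩ := hM
  have h := (hH (p + q) q (by omega)).1
  rw [Nat.add_sub_cancel] at h
  have h1 : (1 : ℝ) ≤ ((p + q).choose q : ℝ) := by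
    exact_mod_cast Nat.choose_pos (by omega)
  have h2 : 0 < M p * M q := mul_pos (hMpos p) (hMpos q)
  nlinarith

lemma StableSeq.exists_le_mul {M : ℕ → ℝ} (hMpos : ∀ p, 0 < M p) (hM : StableSeq M) :
    ∃ H : ℝ, 1 ≤ H ∧ ∀ p q, M (p + q) ≤ H ^ (p + q) * (M p * M q) := by
  obtain ⟨H, hH0, hH⟩ := hM
  refine ⟨max 1 H, le_max_left _ _, fun p q => ?_⟩
  have h := (hH (p + q) q (by omega)).2
  rw [Nat.add_sub_cancel, mul_assoc] at h
  have h2 : 0 < M p * M q := mul_pos (hMpos p) (hMpos q)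
  refine h.trans ?_
  gcongr
  exact le_max_right _ _

/-- The shifted powers that come out of the localization are absorbed by the sequence. -/
lemma exists_rpow_mul_le {M : ℕ → ℝ} (hMpos : ∀ p, 0 < M p) (hM : StableSeq M) {d : ℝ}
    (hd : 0 ≤ d) (hdM : SeqSubordinate (fun p => (p.factorial : ℝ) ^ d) M) {m : ℕ} (hm : 1 ≤ m) :
    ∃ A : ℝ, 1 ≤ A ∧ ∀ l i : ℕ, i ≤ l →
      ((l : ℝ) ^ (d * m)) ^ (l - i) * M (i * m) ≤ A ^ (l + 1) * M (l * m) := by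
  obtain ⟨L, hL, C, hC, h⟩ := hdM
  set A := max 1 C * (max 1 L ^ m * Real.exp (m * d)) with hA
  have hL1 : (1 : ℝ) ≤ max 1 L ^ m := one_le_pow₀ (le_max_left _ _)
  have hE1 : (1 : ℝ) ≤ Real.exp (m * d) := Real.one_le_exp (by positivity)
  have hC1 : (1 : ℝ) ≤ max 1 C := le_max_left _ _
  have hLE : 1 ≤ max 1 L ^ m * Real.exp (m * d) := one_le_mul_of_one_le_of_one_le hL1 hE1
  have hA1 : 1 ≤ A := one_le_mul_of_one_le_of_one_le hC1 hLE
  refine ⟨A, hA1, fun l i hil => ?_⟩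
  obtain ⟨k, rfl⟩ := Nat.exists_eq_add_of_le hil
  rw [Nat.add_sub_cancel_left]
  set l := i + k with hl
  have e1 : ((l : ℝ) ^ (d * m)) ^ k = ((l : ℝ) ^ (m * k)) ^ d := by
    rw [← Real.rpow_natCast, ← Real.rpow_natCast, ← Real.rpow_mul (by positivity),
      ← Real.rpow_mul (by positivity)]
    push_cast
    ring_nf
  -- `x^N / N! ≤ e^x` with `x = m l` and `N = m k`: the base is `l` and not `k`, but the loss is
  -- still only geometric in `l`.
  have e2 : (l : ℝ) ^ (m * k) ≤ ((m * k).factorial : ℝ) * Real.exp (m * l) := by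
    have h1 := Real.pow_div_factorial_le_exp ((m : ℝ) * l) (by positivity) (m * k)
    rw [div_le_iff₀ (by positivity)] at h1
    have hml : (l : ℝ) ≤ m * l := le_mul_of_one_le_left (by positivity) (by exact_mod_cast hm)
    calc (l : ℝ) ^ (m * k) ≤ ((m : ℝ) * l) ^ (m * k) := by gcongr
      _ ≤ _ := by linarith
  have e3 : ((l : ℝ) ^ (m * k)) ^ d ≤ (C * L ^ (m * k) * M (m * k)) * Real.exp (m * d) ^ l := by
    calc ((l : ℝ) ^ (m * k)) ^ d ≤ (((m * k).factorial : ℝ) * Real.exp (m * l)) ^ d := by gcongr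
      _ = ((m * k).factorial : ℝ) ^ d * Real.exp (m * d) ^ l := by
        rw [Real.mul_rpow (by positivity) (by positivity), ← Real.exp_mul, ← Real.exp_nat_mul]
        ring_nf
      _ ≤ _ := by gcongr; exact h (m * k)
  have e4 : C * L ^ (m * k) ≤ max 1 C * (max 1 L ^ m) ^ l := by
    have : L ^ (m * k) ≤ (max 1 L ^ m) ^ l := by
      calc L ^ (m * k) ≤ (max 1 L) ^ (m * k) := by gcongr; exact le_max_right _ _
        _ ≤ (max 1 L) ^ (m * l) := pow_le_pow_right₀ (le_max_left _ _) (by gcongr; omega)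
        _ = _ := by rw [pow_mul]
    gcongr
    exact le_max_right _ _
  have e5 : M (m * k) * M (i * m) ≤ M (l * m) := by
    have := hM.mul_le hMpos (m * k) (i * m)
    rwa [show m * k + i * m = l * m by rw [hl]; ring] at this
  have e6 : max 1 C * ((max 1 L ^ m) * Real.exp (m * d)) ^ l ≤ A ^ (l + 1) := by
    rw [pow_succ']
    gcongr
    · exact le_mul_of_one_le_right (by positivity) hLE
    · exact le_mul_of_one_le_left (by positivity) hC1
  rw [e1]
  have p1 := (hMpos (m * k)).le
  have p2 := (hMpos (i * m)).le
  have p3 := (hMpos (l * m)).le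
  calc ((l : ℝ) ^ (m * k)) ^ d * M (i * m)
      ≤ (C * L ^ (m * k) * M (m * k)) * Real.exp (m * d) ^ l * M (i * m) := by gcongr
    _ = (C * L ^ (m * k)) * Real.exp (m * d) ^ l * (M (m * k) * M (i * m)) := by ring
    _ ≤ (max 1 C * (max 1 L ^ m) ^ l) * Real.exp (m * d) ^ l * M (l * m) := by gcongr
    _ = max 1 C * ((max 1 L ^ m) * Real.exp (m * d)) ^ l * M (l * m) := by rw [mul_pow]; ring
    _ ≤ _ := by gcongr

lemma LogConvexSeq.pow_succ_le {M : ℕ → ℝ} (hMpos : ∀ p, 0 < M p) (hM : LogConvexSeq M) (p : ℕ) :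
    M p ^ (p + 1) ≤ M (p + 1) ^ p := by
  induction p with
  | zero => simp [hM.1]
  | succ p ih =>
    have h := hM.2 (p + 1) (by omega)
    rw [Nat.add_sub_cancel] at h
    have h1 : (M (p + 1) ^ 2) ^ (p + 1) ≤ M p ^ (p + 1) * M (p + 1 + 1) ^ (p + 1) := by
      rw [← mul_pow]
      have := (hMpos (p + 1)).le
      gcongr
    have h2 : M p ^ (p + 1) * M (p + 1 + 1) ^ (p + 1)
        ≤ M (p + 1) ^ p * M (p + 1 + 1) ^ (p + 1) := by
      have := (hMpos (p + 1 + 1)).le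
      gcongr
    have h3 : M (p + 1) ^ p * M (p + 1) ^ (p + 1 + 1)
        ≤ M (p + 1) ^ p * M (p + 1 + 1) ^ (p + 1) := by
      refine le_trans (le_of_eq ?_) (h1.trans h2)
      ring
    exact le_of_mul_le_mul_left h3 (pow_pos (hMpos _) _)

/-- Log-convexity together with `M 0 = 1` makes `M_p^(1/p)` nondecreasing; each single step is
`LogConvexSeq.pow_succ_le`. -/
lemma LogConvexSeq.le_rpow {M : ℕ → ℝ} (hMpos : ∀ p, 0 < M p) (hM : LogConvexSeq M) {s a : ℕ}
    (hs : s ≤ a) (ha : 1 ≤ a) : M s ≤ M a ^ ((s : ℝ) / a) := by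
  rcases Nat.eq_zero_or_pos s with rfl | hs0
  · simp [hM.1]
  have key : M s ^ (1 / (s : ℝ)) ≤ M a ^ (1 / (a : ℝ)) := by
    induction a, hs using Nat.le_induction with
    | base => exact le_rfl
    | succ a hsa ih =>
      have ha0 : 0 < a := by omega
      refine (ih ha0).trans ?_
      have h := hM.pow_succ_le hMpos a
      have h' : M a ≤ M (a + 1) ^ ((a : ℝ) / (a + 1 : ℕ)) := by
        have e : (M (a + 1) ^ ((a : ℝ) / (a + 1 : ℕ))) ^ (a + 1) = M (a + 1) ^ a := by
          rw [← Real.rpow_natCast, ← Real.rpow_mul (hMpos _).le, div_mul_cancel₀ _ (by positivity),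
            Real.rpow_natCast]
        rw [← e] at h
        exact (pow_le_pow_iff_left₀ (hMpos a).le (Real.rpow_nonneg (hMpos _).le _)
          (by omega)).1 h
      calc M a ^ (1 / (a : ℝ)) ≤ (M (a + 1) ^ ((a : ℝ) / (a + 1 : ℕ))) ^ (1 / (a : ℝ)) :=
            Real.rpow_le_rpow (hMpos a).le h' (by positivity)
        _ = _ := by
          rw [← Real.rpow_mul (hMpos _).le]
          congr 1
          field_simp
  calc M s = (M s ^ (1 / (s : ℝ))) ^ (s : ℝ) := by
        rw [← Real.rpow_mul (hMpos s).le, one_div, inv_mul_cancel₀ (by positivity), Real.rpow_one]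
    _ ≤ (M a ^ (1 / (a : ℝ))) ^ (s : ℝ) :=
        Real.rpow_le_rpow (Real.rpow_nonneg (hMpos s).le _) key (by positivity)
    _ = _ := by
      rw [← Real.rpow_mul (hMpos a).le]
      congr 1
      ring

lemma StableSeq.exists_mul_le {M : ℕ → ℝ} (hMpos : ∀ p, 0 < M p) (hM1 : LogConvexSeq M)
    {H : ℝ} (hH1 : 1 ≤ H) (hH : ∀ p q, M (p + q) ≤ H ^ (p + q) * (M p * M q)) (k a : ℕ) :
    M (k * a) ≤ H ^ (k * k * a) * M a ^ k := by
  induction k with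
  | zero => simp [hM1.1]
  | succ k ih =>
    have p1 := (hMpos a).le
    calc M ((k + 1) * a) = M (k * a + a) := by ring_nf
      _ ≤ H ^ (k * a + a) * (M (k * a) * M a) := hH _ _
      _ ≤ H ^ (k * a + a) * ((H ^ (k * k * a) * M a ^ k) * M a) := by gcongr
      _ = H ^ (k * a + a + k * k * a) * M a ^ (k + 1) := by rw [pow_add H (k * a + a)]; ring
      _ ≤ _ := by
        gcongr
        nlinarith

/-- `M_q ≤ A^{a+1} M_a^d` for the integers `q` just above `d a`. -/
lemma exists_le_rpow_of_le {M : ℕ → ℝ} (hMpos : ∀ p, 0 < M p) (hM1 : LogConvexSeq M)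
    (hM : StableSeq M) {d : ℝ} (hd : 0 ≤ d) (m : ℕ) :
    ∃ A : ℝ, 1 ≤ A ∧ ∀ a q : ℕ, d * a ≤ q → (q : ℝ) ≤ d * a + 2 * m →
      M q ≤ A ^ (a + 1) * M a ^ d := by
  obtain ⟨H, hH1, hH⟩ := hM.exists_le_mul hMpos
  set k := ⌊d⌋₊ with hk
  set e := d - k with he
  have he0 : 0 ≤ e := sub_nonneg.2 (Nat.floor_le hd)
  have he1 : e < 1 := by have := Nat.lt_floor_add_one d; rw [he]; linarith
  -- The terms of `M` may lie below `1`, in which case raising the exponent of `M a` from `s/a` to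
  -- `e` lowers the value. The bound `b^a ≤ M a` limits this loss to `b⁻¹^a`.
  set b := min 1 (M 1) with hb
  have hb0 : 0 < b := lt_min one_pos (hMpos 1)
  have hb1 : b ≤ 1 := min_le_left _ _
  have hbM : ∀ a, b ^ a ≤ M a := by
    intro a
    induction a with
    | zero => simp [hM1.1]
    | succ a ih =>
      calc b ^ (a + 1) = b ^ a * b := pow_succ _ _
        _ ≤ M a * M 1 := by
          have := (hMpos a).le
          gcongr
          exact min_le_right _ _
        _ ≤ _ := hM.mul_le hMpos a 1
  set B := 1 + ∑ t ∈ Finset.range (2 * m + 1), M t with hB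
  have hBt : ∀ t, t ≤ 2 * m → M t ≤ B := by
    intro t ht
    have := Finset.single_le_sum (f := M) (fun i _ => (hMpos i).le)
      (Finset.mem_range.2 (Nat.lt_succ_of_le ht))
    rw [hB]; linarith
  have hB1 : 1 ≤ B := le_add_of_nonneg_right (Finset.sum_nonneg fun i _ => (hMpos i).le)
  have hsmall : ∀ a s : ℕ, s = ⌊e * a⌋₊ → M s ≤ b⁻¹ ^ a * M a ^ e := by
    intro a s hs
    rcases Nat.eq_zero_or_pos a with rfl | ha
    · simp [hs, hM1.1]
    have hsle : (s : ℝ) ≤ e * a := by rw [hs]; exact Nat.floor_le (by positivity)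
    have hsa : s ≤ a := by
      have : (s : ℝ) ≤ a := hsle.trans (by
        have : (0 : ℝ) ≤ a := by positivity
        nlinarith)
      exact_mod_cast this
    have ha' : (0 : ℝ) < a := by exact_mod_cast ha
    have hx0 : 0 ≤ e - (s : ℝ) / a := by
      rw [sub_nonneg, div_le_iff₀ ha']; exact hsle
    have hx1 : e - (s : ℝ) / a ≤ 1 := by
      have : 0 ≤ (s : ℝ) / a := by positivity
      linarith
    have h1 : 1 ≤ b⁻¹ ^ a * M a ^ (e - (s : ℝ) / a) := by
      have : (b ^ a) ^ (e - (s : ℝ) / a) ≤ M a ^ (e - (s : ℝ) / a) :=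
        Real.rpow_le_rpow (by positivity) (hbM a) hx0
      have h2 : b ^ a ≤ (b ^ a) ^ (e - (s : ℝ) / a) := by
        have := Real.rpow_le_rpow_of_exponent_ge (x := b ^ a) (by positivity)
          (pow_le_one₀ hb0.le hb1) hx1
        simpa using this
      calc (1 : ℝ) = b⁻¹ ^ a * b ^ a := by rw [← mul_pow, inv_mul_cancel₀ hb0.ne', one_pow]
        _ ≤ _ := by gcongr; exact h2.trans this
    calc M s ≤ M a ^ ((s : ℝ) / a) := hM1.le_rpow hMpos hsa ha
      _ ≤ M a ^ ((s : ℝ) / a) * (b⁻¹ ^ a * M a ^ (e - (s : ℝ) / a)) :=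
        le_mul_of_one_le_right (Real.rpow_nonneg (hMpos a).le _) h1
      _ = b⁻¹ ^ a * (M a ^ ((s : ℝ) / a) * M a ^ (e - (s : ℝ) / a)) := by ring
      _ = _ := by rw [← Real.rpow_add (hMpos a)]; congr 2; ring
  set D := H ^ (2 * (k + 1) + k * k) * b⁻¹ with hD
  have hbi : 1 ≤ b⁻¹ := (one_le_inv₀ hb0).2 hb1
  have hD1 : 1 ≤ D := one_le_mul_of_one_le_of_one_le (one_le_pow₀ hH1) hbi
  have hF1 : 1 ≤ H ^ (2 * m) * B := one_le_mul_of_one_le_of_one_le (one_le_pow₀ hH1) hB1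
  refine ⟨H ^ (2 * m) * B * D, one_le_mul_of_one_le_of_one_le hF1 hD1, fun a q h1 h2 => ?_⟩
  set s := ⌊e * a⌋₊ with hs
  have hsle : (s : ℝ) ≤ e * a := Nat.floor_le (by positivity)
  have hslt : e * a < s + 1 := Nat.lt_floor_add_one _
  have hsa : s ≤ a := by
    have : (s : ℝ) ≤ a := hsle.trans (by
      have : (0 : ℝ) ≤ a := by positivity
      nlinarith)
    exact_mod_cast this
  have hde : d * a = k * a + e * a := by rw [he]; ring
  have hq1 : k * a + s ≤ q := by
    have : ((k * a + s : ℕ) : ℝ) ≤ q := by push_cast; linarith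
    exact_mod_cast this
  -- Here `q = k a + s + t`: stability compares `M (k a)` with `M a ^ k`, log-convexity compares `M
  -- s` with `M a ^ e`, and `t ≤ 2 m` takes finitely many values.
  obtain ⟨t, rfl⟩ := Nat.exists_eq_add_of_le hq1
  have ht : t ≤ 2 * m := by
    have : (t : ℝ) < 2 * m + 1 := by push_cast at h2; linarith
    have : t < 2 * m + 1 := by exact_mod_cast this
    omega
  have p1 := (hMpos a).le
  have p2 := (hMpos s).le
  have p3 := (hMpos t).le
  have p4 := (hMpos (k * a)).le
  have p5 : 0 ≤ M a ^ e := Real.rpow_nonneg p1 _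
  have hB0 : 0 ≤ B := by linarith
  calc M (k * a + s + t) ≤ H ^ (k * a + s + t) * (M (k * a + s) * M t) := hH _ _
    _ ≤ H ^ (k * a + s + t) * ((H ^ (k * a + s) * (M (k * a) * M s)) * M t) := by
        gcongr; exact hH _ _
    _ ≤ H ^ (k * a + a + 2 * m) * ((H ^ (k * a + a) * ((H ^ (k * k * a) * M a ^ k) *
          (b⁻¹ ^ a * M a ^ e))) * B) := by
        gcongr
        · exact StableSeq.exists_mul_le hMpos hM1 hH1 hH k a
        · exact hsmall a s rfl
        · exact hBt t ht
    _ = (H ^ (2 * m) * B) * D ^ a * (M a ^ k * M a ^ e) := by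
        rw [hD, mul_pow, ← pow_mul, show (2 * (k + 1) + k * k) * a
          = (k * a + a) + (k * a + a) + k * k * a by ring]
        simp only [pow_add]
        ring
    _ = (H ^ (2 * m) * B) * D ^ a * M a ^ d := by
        rw [← Real.rpow_natCast (M a) k, ← Real.rpow_add (hMpos a)]
        congr 2
        rw [he]; ring
    _ ≤ _ := by
        have : 0 ≤ M a ^ d := Real.rpow_nonneg p1 _
        gcongr
        generalize H ^ (2 * m) * B = X at hF1
        have hX : 0 ≤ X := by linarith
        have hD0 : 0 ≤ D := by linarith
        rw [pow_succ']
        calc X * D ^ a ≤ (X * D) * (X * D) ^ a := by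
              gcongr
              · exact le_mul_of_one_le_right hX hD1
              · exact le_mul_of_one_le_left hD0 hF1
          _ = _ := rfl

/-! ### Cutoffs on the line with controlled derivatives -/

/-- The mean of `f` over the interval of radius `ε` around a point. -/
noncomputable def intervalMean (ε : ℝ) (f : ℝ → ℝ) (x : ℝ) : ℝ :=
  (2 * ε)⁻¹ * ∫ t in (x - ε)..(x + ε), f t

lemma hasDerivAt_intervalMean {f : ℝ → ℝ} (hf : Continuous f) (ε x : ℝ) :
    HasDerivAt (intervalMean ε f) ((2 * ε)⁻¹ * (f (x + ε) - f (x - ε))) x := by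
  have hi : ∀ a b, IntervalIntegrable f volume a b := fun a b => hf.intervalIntegrable a b
  have e : intervalMean ε f = fun x => (2 * ε)⁻¹ * ((∫ t in (0)..(x + ε), f t)
      - ∫ t in (0)..(x - ε), f t) := by
    funext y
    rw [intervalMean, intervalIntegral.integral_interval_sub_left (hi _ _) (hi _ _)]
  rw [e]
  have h : ∀ y, HasDerivAt (fun u => ∫ t in (0)..u, f t) (f y) y := fun y =>
    intervalIntegral.integral_hasDerivAt_right (hi _ _)
      (hf.stronglyMeasurableAtFilter _ _) hf.continuousAt
  refine HasDerivAt.const_mul _ (HasDerivAt.sub ?_ ?_)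
  · simpa using (h (x + ε)).comp_add_const x ε
  · simpa using (h (x - ε)).comp_sub_const x ε

lemma contDiff_intervalMean {f : ℝ → ℝ} (hf : ContDiff ℝ ∞ f) (ε : ℝ) :
    ContDiff ℝ ∞ (intervalMean ε f) := by
  rw [contDiff_infty_iff_deriv]
  refine ⟨fun x => (hasDerivAt_intervalMean hf.continuous ε x).differentiableAt, ?_⟩
  rw [show deriv (intervalMean ε f) = _ from
    funext fun x => (hasDerivAt_intervalMean hf.continuous ε x).deriv]
  fun_prop

lemma abs_intervalMean_le {f : ℝ → ℝ} {ε B : ℝ} (hε : 0 < ε) (h : ∀ t, |f t| ≤ B) (x : ℝ) :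
    |intervalMean ε f x| ≤ B := by
  have := intervalIntegral.norm_integral_le_of_norm_le_const (a := x - ε) (b := x + ε) (f := f)
    (C := B) (fun t _ => h t)
  rw [Real.norm_eq_abs, show x + ε - (x - ε) = 2 * ε by ring,
    abs_of_pos (by positivity : 0 < 2 * ε)] at this
  rw [intervalMean, abs_mul, abs_of_pos (by positivity : 0 < (2 * ε)⁻¹),
    inv_mul_le_iff₀ (by positivity)]
  linarith

lemma intervalMean_eq_of_eq {f : ℝ → ℝ} {ε c x : ℝ} (hε : 0 < ε)
    (h : ∀ t, |t - x| ≤ ε → f t = c) : intervalMean ε f x = c := by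
  have : ∫ t in (x - ε)..(x + ε), f t = ∫ t in (x - ε)..(x + ε), c := by
    refine intervalIntegral.integral_congr fun t ht => h t ?_
    rw [Set.uIcc_of_le (by linarith)] at ht
    exact abs_le.2 ⟨by linarith [ht.1], by linarith [ht.2]⟩
  rw [intervalMean, this, intervalIntegral.integral_const, smul_eq_mul]
  field_simp
  ring

lemma iteratedDeriv_succ_intervalMean {f : ℝ → ℝ} (hf : ContDiff ℝ ∞ f) (ε : ℝ) (j : ℕ) (x : ℝ) :
    iteratedDeriv (j + 1) (intervalMean ε f) x =
      (2 * ε)⁻¹ * (iteratedDeriv j f (x + ε) - iteratedDeriv j f (x - ε)) := by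
  have hj : ContDiff ℝ j f := hf.of_le (by exact_mod_cast le_top)
  rw [iteratedDeriv_succ', show deriv (intervalMean ε f) = _ from
    funext fun x => (hasDerivAt_intervalMean hf.continuous ε x).deriv,
    iteratedDeriv_const_mul_field, iteratedDeriv_fun_sub, iteratedDeriv_comp_add_const,
    iteratedDeriv_comp_sub_const]
  · exact (hj.comp (contDiff_id.add contDiff_const)).contDiffAt
  · exact (hj.comp (contDiff_id.sub contDiff_const)).contDiffAt

/-- A bump is averaged `k` times. Differentiating a mean produces a difference quotient of the
previous function, so each derivative consumes one average and costs `ε⁻¹`; the derivatives of the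
initial bump never enter. Each average shrinks both plateaus by `ε`. -/
lemma exists_cutoff_aux {r δ ε : ℝ} (hr : 0 ≤ r) (hδ : 0 < δ) (hε : 0 < ε) (k : ℕ) :
    ∃ f : ℝ → ℝ, ContDiff ℝ ∞ f ∧ (∀ t, |t| ≤ r + δ / 2 - k * ε → f t = 1) ∧
      (∀ t, r + 3 / 4 * δ + k * ε ≤ |t| → f t = 0) ∧
      ∀ j ≤ k, ∀ t, |iteratedDeriv j f t| ≤ ε⁻¹ ^ j := by
  induction k with
  | zero =>
    let φ : ContDiffBump (0 : ℝ) := ⟨r + δ / 2, r + 3 / 4 * δ, by positivity, by linarith⟩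
    refine ⟨φ, φ.contDiff, fun t ht => φ.one_of_mem_closedBall ?_,
      fun t ht => φ.zero_of_le_dist ?_, fun j hj t => ?_⟩
    · simpa [φ] using ht
    · simpa [φ] using ht
    · obtain rfl : j = 0 := by omega
      simpa [abs_of_nonneg φ.nonneg] using φ.le_one
  | succ k ih =>
    obtain ⟨f, hf, h1, h0, hb⟩ := ih
    push_cast
    refine ⟨intervalMean ε f, contDiff_intervalMean hf ε, fun t ht => ?_, fun t ht => ?_, ?_⟩
    · refine intervalMean_eq_of_eq hε fun y hy => h1 y ?_
      have := abs_sub_abs_le_abs_sub y t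
      linarith
    · refine intervalMean_eq_of_eq hε fun y hy => h0 y ?_
      have := abs_sub_abs_le_abs_sub t y
      rw [abs_sub_comm] at this
      linarith
    · intro j hj t
      rcases j with _ | j
      · have := abs_intervalMean_le (f := f) (B := 1) hε
          (fun t => by simpa using hb 0 (Nat.zero_le _) t) t
        simpa using this
      · rw [iteratedDeriv_succ_intervalMean hf, abs_mul, abs_of_pos (by positivity)]
        have ha := hb j (by omega) (t + ε)
        have hc := hb j (by omega) (t - ε)
        have hs := abs_sub (iteratedDeriv j f (t + ε)) (iteratedDeriv j f (t - ε))
        calc (2 * ε)⁻¹ * |iteratedDeriv j f (t + ε) - iteratedDeriv j f (t - ε)|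
            ≤ (2 * ε)⁻¹ * (ε⁻¹ ^ j + ε⁻¹ ^ j) := by gcongr; linarith
          _ = _ := by rw [pow_succ]; field_simp; ring

/-- Cutoff functions on the line whose first `N` derivatives grow geometrically. -/
lemma exists_cutoff_real {r δ : ℝ} (hr : 0 ≤ r) (hδ : 0 < δ) {N : ℕ} (hN : 1 ≤ N) :
    ∃ f : ℝ → ℝ, ContDiff ℝ ∞ f ∧ (∀ t, |t| ≤ r → f t = 1) ∧ (∀ t, r + δ ≤ |t| → f t = 0) ∧
      ∀ j ≤ N, ∀ t, |iteratedDeriv j f t| ≤ (4 * N / δ) ^ j := by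
  have hN' : (0 : ℝ) < N := by exact_mod_cast hN
  -- `N` averages of radius `δ/(4N)` move each plateau by `δ/4`, exactly the room left by the bump
  -- on either side.
  obtain ⟨f, hf, h1, h0, hb⟩ := exists_cutoff_aux hr hδ (ε := δ / (4 * N)) (by positivity) N
  have e : (N : ℝ) * (δ / (4 * N)) = δ / 4 := by field_simp
  rw [e] at h1 h0
  refine ⟨f, hf, fun t ht => h1 t (by linarith), fun t ht => h0 t (by linarith), fun j hj t => ?_⟩
  simpa using hb j hj t

/-! ### Taylor coefficients of the symbol -/

namespace MvPolynomial

/-- Iterated partial derivatives of a polynomial, in the order used for `symbolDeriv`. -/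
noncomputable def iterPDeriv {n : ℕ} {R : Type*} [CommSemiring R] (β : Fin n →₀ ℕ)
    (P : MvPolynomial (Fin n) R) : MvPolynomial (Fin n) R :=
  (List.finRange n).foldr (fun j P => (fun S => pderiv j S)^[β j] P) P

lemma exists_coeff_iterate_pderiv {n : ℕ} {R : Type*} [CommSemiring R] (j : Fin n) (k : ℕ)
    (γ : Fin n →₀ ℕ) : ∃ c : ℕ, c ≠ 0 ∧ ∀ P : MvPolynomial (Fin n) R,
      coeff γ ((fun S => pderiv j S)^[k] P) = c * coeff (γ + Finsupp.single j k) P := by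
  induction k generalizing γ with
  | zero => exact ⟨1, one_ne_zero, fun P => by simp⟩
  | succ k ih =>
    obtain ⟨c, hc, h⟩ := ih (γ + Finsupp.single j 1)
    refine ⟨c * (γ j + 1), by positivity, fun P => ?_⟩
    rw [Function.iterate_succ_apply', coeff_pderiv, h, add_assoc, ← Finsupp.single_add,
      add_comm 1 k]
    push_cast
    ring

/-- The factor does not depend on the polynomial, and the coefficient ring is arbitrary so that the
formula also applies to Taylor polynomials over `ℂ[X]`. -/
lemma exists_coeff_iterPDeriv {n : ℕ} (R : Type*) [CommSemiring R] (β γ : Fin n →₀ ℕ) :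
    ∃ c : ℕ, c ≠ 0 ∧ ∀ P : MvPolynomial (Fin n) R,
      coeff γ (iterPDeriv β P) = c * coeff (γ + β) P := by
  have key : ∀ (L : List (Fin n)) (γ : Fin n →₀ ℕ), ∃ c : ℕ, c ≠ 0 ∧
      ∀ P : MvPolynomial (Fin n) R,
      coeff γ (L.foldr (fun j P => (fun S => pderiv j S)^[β j] P) P)
        = c * coeff (γ + (L.map fun j => Finsupp.single j (β j)).sum) P := by
    intro L
    induction L with
    | nil => exact fun γ => ⟨1, one_ne_zero, fun P => by simp⟩
    | cons j L ih =>
      intro γ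
      obtain ⟨c, hc, h⟩ := exists_coeff_iterate_pderiv (R := R) j (β j) γ
      obtain ⟨c', hc', h'⟩ := ih (γ + Finsupp.single j (β j))
      refine ⟨c * c', mul_ne_zero hc hc', fun P => ?_⟩
      rw [List.foldr_cons, h, h', List.map_cons, List.sum_cons, add_assoc]
      push_cast
      ring
  obtain ⟨c, hc, h⟩ := key (List.finRange n) γ
  refine ⟨c, hc, fun P => ?_⟩
  rw [iterPDeriv, h]
  congr 3
  rw [← List.ofFn_eq_map, List.sum_ofFn]
  exact Finsupp.univ_sum_single β

/-- The Taylor expansion `P(X + Y)`, as a polynomial in `Y` with coefficients in `ℂ[X]`. -/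
noncomputable def taylorHom (n : ℕ) :
    MvPolynomial (Fin n) ℂ →ₐ[ℂ] MvPolynomial (Fin n) (MvPolynomial (Fin n) ℂ) :=
  aeval fun j => X j + C (X j)

lemma taylorHom_C {n : ℕ} (a : ℂ) : taylorHom n (C a) = C (C a) := by
  rw [taylorHom, aeval_C]; rfl

lemma taylorHom_X {n : ℕ} (j : Fin n) : taylorHom n (X j) = X j + C (X j) := by
  rw [taylorHom, aeval_X]

lemma pderiv_taylorHom {n : ℕ} (j : Fin n) (P : MvPolynomial (Fin n) ℂ) :
    pderiv j (taylorHom n P) = taylorHom n (pderiv j P) := by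
  induction P using MvPolynomial.induction_on with
  | C a => simp
  | add p q hp hq => simp [hp, hq]
  | mul_X p i hp =>
    simp only [map_mul, pderiv_mul, hp, taylorHom_X, map_add, pderiv_C, add_zero, pderiv_X]
    rcases eq_or_ne j i with rfl | h
    · simp
    · simp [h]

lemma coeff_zero_taylorHom {n : ℕ} (P : MvPolynomial (Fin n) ℂ) :
    coeff 0 (taylorHom n P) = P := by
  change constantCoeff (taylorHom n P) = P
  induction P using MvPolynomial.induction_on with
  | C a => simp
  | add p q hp hq => simp [hp, hq]
  | mul_X p i hp => simp [hp, taylorHom_X]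

lemma iterPDeriv_taylorHom {n : ℕ} (β : Fin n →₀ ℕ) (P : MvPolynomial (Fin n) ℂ) :
    iterPDeriv β (taylorHom n P) = taylorHom n (iterPDeriv β P) := by
  have h1 : ∀ (j : Fin n) (k : ℕ) (P : MvPolynomial (Fin n) ℂ),
      (fun S => pderiv j S)^[k] (taylorHom n P) = taylorHom n ((fun S => pderiv j S)^[k] P) := by
    intro j k
    induction k with
    | zero => exact fun P => rfl
    | succ k ih => intro P; rw [Function.iterate_succ_apply', ih, Function.iterate_succ_apply',
        pderiv_taylorHom]
  unfold iterPDeriv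
  induction List.finRange n with
  | nil => rfl
  | cons j L ih => rw [List.foldr_cons, ih, h1, List.foldr_cons]

/-- The Taylor coefficient `Q^{(β)} / β!`. -/
noncomputable def hasse {n : ℕ} (β : Fin n →₀ ℕ) (P : MvPolynomial (Fin n) ℂ) :
    MvPolynomial (Fin n) ℂ :=
  coeff β (taylorHom n P)

lemma hasse_zero {n : ℕ} (P : MvPolynomial (Fin n) ℂ) : hasse 0 P = P := coeff_zero_taylorHom P

/-- Differentiating `P(X + Y)` in `Y` is the same as differentiating `P` first; the two sides are
compared at `Y = 0`. Only the nonvanishing of the factor is needed later. -/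
lemma exists_symbolDeriv_eq {n : ℕ} (β : Fin n →₀ ℕ) (P : MvPolynomial (Fin n) ℂ) :
    ∃ c : ℕ, c ≠ 0 ∧ symbolDeriv β P = c * hasse β P := by
  obtain ⟨c, hc, h⟩ := exists_coeff_iterPDeriv (MvPolynomial (Fin n) ℂ) β 0
  refine ⟨c, hc, ?_⟩
  have := h (taylorHom n P)
  rw [iterPDeriv_taylorHom, coeff_zero_taylorHom, zero_add] at this
  exact this

lemma degree_add_le_of_coeff_symbolDeriv_ne_zero {n : ℕ} {β γ : Fin n →₀ ℕ}
    {P : MvPolynomial (Fin n) ℂ} (h : coeff γ (symbolDeriv β P) ≠ 0) :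
    γ.degree + β.degree ≤ P.totalDegree := by
  obtain ⟨c, hc, h'⟩ := exists_coeff_iterPDeriv ℂ β γ
  have h2 : coeff γ (symbolDeriv β P) = c * coeff (γ + β) P := h' P
  rw [h2] at h
  have := le_totalDegree (mem_support_iff.2 (right_ne_zero_of_mul h))
  rwa [show ((γ + β).sum fun _ e => e) = (γ + β).degree from rfl, map_add] at this

lemma degree_le_of_hasse_ne_zero {n : ℕ} {β : Fin n →₀ ℕ} {P : MvPolynomial (Fin n) ℂ}
    (h : hasse β P ≠ 0) : β.degree ≤ P.totalDegree := by
  obtain ⟨c, hc, h'⟩ := exists_symbolDeriv_eq β P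
  have hne : symbolDeriv β P ≠ 0 := by
    rw [h']
    exact mul_ne_zero (by exact_mod_cast hc) h
  obtain ⟨γ, hγ⟩ := ne_zero_iff.1 hne
  have := degree_add_le_of_coeff_symbolDeriv_ne_zero hγ
  omega

end MvPolynomial

/-! ### Pointwise estimates for the symbol -/

section symbol

variable {n : ℕ}

lemma symbolAt_mul (P R : MvPolynomial (Fin n) ℂ) (ξ : EuclideanSpace ℝ (Fin n)) :
    symbolAt (P * R) ξ = symbolAt P ξ * symbolAt R ξ := by simp [symbolAt]

lemma symbolAt_add (P R : MvPolynomial (Fin n) ℂ) (ξ : EuclideanSpace ℝ (Fin n)) :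
    symbolAt (P + R) ξ = symbolAt P ξ + symbolAt R ξ := by simp [symbolAt]

lemma symbolAt_pow (P : MvPolynomial (Fin n) ℂ) (l : ℕ) (ξ : EuclideanSpace ℝ (Fin n)) :
    symbolAt (P ^ l) ξ = symbolAt P ξ ^ l := by simp [symbolAt]

lemma norm_symbolAt_monomial_le (α : Fin n →₀ ℕ) (ξ : EuclideanSpace ℝ (Fin n)) :
    ‖symbolAt (MvPolynomial.monomial α 1) ξ‖ ≤ ‖ξ‖ ^ α.degree := by
  rw [symbolAt, MvPolynomial.eval_monomial, one_mul, Finsupp.degree_eq_sum, Finsupp.prod_fintype]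
  · rw [norm_prod, ← Finset.prod_pow_eq_pow_sum]
    refine Finset.prod_le_prod (fun _ _ => norm_nonneg _) fun i _ => ?_
    rw [norm_pow, Complex.norm_real]
    gcongr
    exact PiLp.norm_apply_le ξ i
  · simp

lemma exists_norm_symbolAt_le (P : MvPolynomial (Fin n) ℂ) (k : ℕ)
    (hk : ∀ γ, P.coeff γ ≠ 0 → γ.degree ≤ k) :
    ∃ C : ℝ, 0 ≤ C ∧ ∀ ξ, ‖symbolAt P ξ‖ ≤ C * (1 + ‖ξ‖) ^ k := by
  refine ⟨∑ γ ∈ P.support, ‖P.coeff γ‖, by positivity, fun ξ => ?_⟩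
  have e : symbolAt P ξ = ∑ γ ∈ P.support, P.coeff γ * symbolAt (MvPolynomial.monomial γ 1) ξ := by
    conv_lhs => rw [symbolAt, P.as_sum, map_sum]
    refine Finset.sum_congr rfl fun γ _ => ?_
    simp [symbolAt, MvPolynomial.eval_monomial]
  rw [e, Finset.sum_mul]
  refine norm_sum_le_of_le _ fun γ hγ => ?_
  rw [norm_mul]
  gcongr
  calc ‖symbolAt (MvPolynomial.monomial γ 1) ξ‖ ≤ ‖ξ‖ ^ γ.degree := norm_symbolAt_monomial_le γ ξ
    _ ≤ (1 + ‖ξ‖) ^ γ.degree := by gcongr; linarith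
    _ ≤ _ := pow_le_pow_right₀ (by linarith [norm_nonneg ξ]) (hk γ (MvPolynomial.mem_support_iff.1 hγ))

/-- The parameter `t` stands for an inverse length. Where `‖ξ‖ ≥ t^d` the hypothesis applies, since
then `t^|β| ≤ ‖ξ‖^(|β|/d)`; where `‖ξ‖ ≤ t^d` the degree bound on `Q^(β)` alone gives `t^(d m)`. -/
lemma HypoellipticEstimate.exists_symbolDeriv_le {Q : MvPolynomial (Fin n) ℂ} {d : ℝ}
    (h : HypoellipticEstimate Q d) (hd : 1 ≤ d) (β : Fin n →₀ ℕ) :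
    ∃ C : ℝ, 0 ≤ C ∧ ∀ t : ℝ, 1 ≤ t → ∀ ξ,
      t ^ β.degree * ‖symbolAt (symbolDeriv β Q) ξ‖ ≤
        C * (‖symbolAt Q ξ‖ + t ^ (d * Q.totalDegree)) := by
  obtain ⟨C₁, hC₁, h⟩ := h
  obtain ⟨C₂, hC₂, h₂⟩ := exists_norm_symbolAt_le (symbolDeriv β Q) (Q.totalDegree - β.degree)
    fun γ hγ => by
      have := MvPolynomial.degree_add_le_of_coeff_symbolDeriv_ne_zero hγ
      omega
  refine ⟨C₁ + C₂ * 2 ^ (Q.totalDegree - β.degree), by positivity, fun t ht ξ => ?_⟩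
  have ht0 : 0 < t := by linarith
  have hts : 1 ≤ t ^ (d * Q.totalDegree) := Real.one_le_rpow ht (by positivity)
  have htd : 1 ≤ t ^ d := Real.one_le_rpow ht (by positivity)
  have hq := norm_nonneg (symbolAt Q ξ)
  by_cases hb : β.degree ≤ Q.totalDegree
  · rcases le_total (t ^ d) ‖ξ‖ with hξ | hξ
    · have e : t ^ β.degree ≤ ‖ξ‖ ^ ((β.degree : ℝ) / d) := by
        calc t ^ β.degree = (t ^ d) ^ ((β.degree : ℝ) / d) := by
              rw [← Real.rpow_mul ht0.le, mul_div_cancel₀ _ (by positivity), Real.rpow_natCast]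
          _ ≤ _ := by gcongr
      calc t ^ β.degree * ‖symbolAt (symbolDeriv β Q) ξ‖
          ≤ ‖ξ‖ ^ ((β.degree : ℝ) / d) * ‖symbolAt (symbolDeriv β Q) ξ‖ := by gcongr
        _ ≤ C₁ * (1 + ‖symbolAt Q ξ‖) := h β ξ
        _ ≤ C₁ * (‖symbolAt Q ξ‖ + t ^ (d * Q.totalDegree)) := by gcongr C₁ * ?_; linarith
        _ ≤ _ := by gcongr; exact le_add_of_nonneg_right (by positivity)
    -- Replacing `t` by `t^d`, which is where `d ≥ 1` enters, makes the exponents add up to `d m`.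
    · have e1 : t ^ β.degree ≤ (t ^ d) ^ β.degree := by
        gcongr
        simpa using Real.rpow_le_rpow_of_exponent_le ht hd
      calc t ^ β.degree * ‖symbolAt (symbolDeriv β Q) ξ‖
          ≤ (t ^ d) ^ β.degree * (C₂ * (1 + ‖ξ‖) ^ (Q.totalDegree - β.degree)) := by
            gcongr; exact h₂ ξ
        _ ≤ (t ^ d) ^ β.degree * (C₂ * (2 * t ^ d) ^ (Q.totalDegree - β.degree)) := by
            gcongr; linarith
        _ = C₂ * 2 ^ (Q.totalDegree - β.degree) *
              (t ^ d) ^ (β.degree + (Q.totalDegree - β.degree)) := by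
            rw [mul_pow, pow_add]; ring
        _ = C₂ * 2 ^ (Q.totalDegree - β.degree) * t ^ (d * Q.totalDegree) := by
            rw [Nat.add_sub_cancel' hb, Real.rpow_mul ht0.le, Real.rpow_natCast]
        _ ≤ _ := by
            gcongr
            · exact le_add_of_nonneg_left hC₁.le
            · linarith
  · have : symbolDeriv β Q = 0 := by
      ext γ
      by_contra hγ
      have := MvPolynomial.degree_add_le_of_coeff_symbolDeriv_ne_zero hγ
      omega
    rw [this]
    simp only [symbolAt, map_zero, norm_zero, mul_zero]
    positivity

/-- The hypoellipticity estimate, scaled. -/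
lemma HypoellipticEstimate.exists_hasse_le {Q : MvPolynomial (Fin n) ℂ} {d : ℝ}
    (h : HypoellipticEstimate Q d) (hd : 1 ≤ d) (S : Finset (Fin n →₀ ℕ)) :
    ∃ C : ℝ, 1 ≤ C ∧ ∀ β ∈ S, ∀ t : ℝ, 1 ≤ t → ∀ ξ,
      t ^ β.degree * ‖symbolAt (MvPolynomial.hasse β Q) ξ‖ ≤
        C * (‖symbolAt Q ξ‖ + t ^ (d * Q.totalDegree)) := by
  choose C hC h using h.exists_symbolDeriv_le hd
  refine ⟨1 + ∑ β ∈ S, C β, le_add_of_nonneg_right (Finset.sum_nonneg fun β _ => hC β),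
    fun β hβ t ht ξ => ?_⟩
  have ht0 : 0 < t := by linarith
  have hCβ : C β ≤ 1 + ∑ β ∈ S, C β := by
    have := Finset.single_le_sum (f := C) (fun i _ => hC i) hβ
    linarith
  obtain ⟨c, hc, hcβ⟩ := MvPolynomial.exists_symbolDeriv_eq β Q
  have e : ‖symbolAt (MvPolynomial.hasse β Q) ξ‖ ≤ ‖symbolAt (symbolDeriv β Q) ξ‖ := by
    rw [hcβ, symbolAt_mul, norm_mul]
    refine le_mul_of_one_le_left (norm_nonneg _) ?_
    have : symbolAt (c : MvPolynomial (Fin n) ℂ) ξ = c := by simp [symbolAt]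
    rw [this, Complex.norm_natCast]
    exact_mod_cast Nat.one_le_iff_ne_zero.2 hc
  have hts : 0 ≤ t ^ (d * Q.totalDegree) := by positivity
  calc t ^ β.degree * ‖symbolAt (MvPolynomial.hasse β Q) ξ‖
      ≤ t ^ β.degree * ‖symbolAt (symbolDeriv β Q) ξ‖ := by gcongr
    _ ≤ C β * (‖symbolAt Q ξ‖ + t ^ (d * Q.totalDegree)) := h β t ht ξ
    _ ≤ _ := by gcongr

lemma HypoellipticEstimate.exists_norm_rpow_le {Q : MvPolynomial (Fin n) ℂ} {d : ℝ}
    (h : HypoellipticEstimate Q d) (hQ : 1 ≤ Q.totalDegree) :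
    ∃ C : ℝ, 1 ≤ C ∧ ∀ ξ, ‖ξ‖ ^ ((Q.totalDegree : ℝ) / d) ≤ C * (1 + ‖symbolAt Q ξ‖) := by
  obtain ⟨C, hC, h⟩ := h
  have hne : Q ≠ 0 := by rintro rfl; simp at hQ
  -- For an exponent `β` of top degree in `Q`, the derivative `Q^(β)` is a nonzero constant, so the
  -- hypothesis bounds `‖ξ‖^(m/d)` itself.
  obtain ⟨β, hβ, hdeg⟩ := Finset.exists_mem_eq_sup Q.support
    (MvPolynomial.support_nonempty.2 hne) (fun s => s.sum fun _ e => e)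
  have hdeg' : β.degree = Q.totalDegree := hdeg.symm
  obtain ⟨c, hc, hcoeff⟩ := MvPolynomial.exists_coeff_iterPDeriv ℂ β 0
  have h0 : MvPolynomial.coeff 0 (symbolDeriv β Q) ≠ 0 := by
    have : MvPolynomial.coeff 0 (symbolDeriv β Q) = c * MvPolynomial.coeff (0 + β) Q := hcoeff Q
    rw [this, zero_add]
    exact mul_ne_zero (by exact_mod_cast hc) (MvPolynomial.mem_support_iff.1 hβ)
  set a := MvPolynomial.coeff 0 (symbolDeriv β Q) with ha
  have hconst : symbolDeriv β Q = MvPolynomial.C a := by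
    ext γ
    rw [MvPolynomial.coeff_C]
    split_ifs with hγ
    · rw [← hγ]
    · by_contra hne
      have := MvPolynomial.degree_add_le_of_coeff_symbolDeriv_ne_zero hne
      have h2 : γ.degree = 0 := by omega
      exact hγ ((Finsupp.degree_eq_zero_iff γ).1 h2).symm
  have ha0 : 0 < ‖a‖ := norm_pos_iff.2 h0
  refine ⟨max 1 (C / ‖a‖), le_max_left _ _, fun ξ => ?_⟩
  have h1 := h β ξ
  rw [hconst, hdeg', symbolAt, MvPolynomial.eval_C, ← le_div_iff₀ ha0] at h1
  refine h1.trans ?_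
  rw [mul_div_right_comm]
  have := norm_nonneg (symbolAt Q ξ)
  gcongr
  exact le_max_right _ _

/-- Monomials are dominated by the powers of the symbol. -/
lemma HypoellipticEstimate.exists_monomial_le {Q : MvPolynomial (Fin n) ℂ} {d : ℝ}
    (h : HypoellipticEstimate Q d) (hd : 1 ≤ d) (hQ : 1 ≤ Q.totalDegree) :
    ∃ C : ℝ, 1 ≤ C ∧ ∀ (α : Fin n →₀ ℕ) (l : ℕ), d * α.degree ≤ l * Q.totalDegree → ∀ ξ,
      ‖symbolAt (MvPolynomial.monomial α 1) ξ‖ ≤ C ^ l * ‖symbolAt (Q ^ l) ξ‖ + C ^ l := by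
  obtain ⟨C, hC, h⟩ := h.exists_norm_rpow_le hQ
  refine ⟨2 * C, by linarith, fun α l hl ξ => ?_⟩
  have hq := norm_nonneg (symbolAt Q ξ)
  have key : ‖ξ‖ ^ α.degree ≤ (C * (1 + ‖symbolAt Q ξ‖)) ^ l := by
    rcases le_total ‖ξ‖ 1 with h1 | h1
    · exact (pow_le_one₀ (norm_nonneg _) h1).trans
        (one_le_pow₀ (one_le_mul_of_one_le_of_one_le hC (by linarith)))
    · calc ‖ξ‖ ^ α.degree = ‖ξ‖ ^ (α.degree : ℝ) := (Real.rpow_natCast _ _).symm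
        _ ≤ ‖ξ‖ ^ ((Q.totalDegree : ℝ) / d * l) := by
          refine Real.rpow_le_rpow_of_exponent_le h1 ?_
          rw [div_mul_eq_mul_div, le_div_iff₀ (by positivity)]
          linarith
        _ = (‖ξ‖ ^ ((Q.totalDegree : ℝ) / d)) ^ l := by
          rw [Real.rpow_mul (norm_nonneg _), Real.rpow_natCast]
        _ ≤ _ := by gcongr; exact h ξ
  refine (norm_symbolAt_monomial_le α ξ).trans (key.trans ?_)
  rw [symbolAt_pow, norm_pow, mul_pow, mul_pow]
  have h2 : (1 + ‖symbolAt Q ξ‖) ^ l ≤ 2 ^ l * (1 + ‖symbolAt Q ξ‖ ^ l) := by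
    have := add_pow_le (zero_le_one' ℝ) hq l
    rw [one_pow] at this
    refine this.trans ?_
    gcongr
    · norm_num
    · omega
  calc C ^ l * (1 + ‖symbolAt Q ξ‖) ^ l ≤ C ^ l * (2 ^ l * (1 + ‖symbolAt Q ξ‖ ^ l)) := by gcongr
    _ = _ := by ring

end symbol

/-! ### Constant coefficient operators as Fourier multipliers -/

/-- Schwartz functions on `ℝⁿ`. -/
abbrev Schwartz (n : ℕ) : Type := SchwartzMap (EuclideanSpace ℝ (Fin n)) ℂ

section operators

variable {n : ℕ}

lemma hasTemperateGrowth_symbolAt (P : MvPolynomial (Fin n) ℂ) :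
    Function.HasTemperateGrowth (symbolAt P) := by
  induction P using MvPolynomial.induction_on with
  | C a =>
    have : symbolAt (MvPolynomial.C a : MvPolynomial (Fin n) ℂ) = fun _ => a := by
      funext ξ; simp [symbolAt]
    rw [this]; fun_prop
  | add p q hp hq =>
    have : symbolAt (p + q) = symbolAt p + symbolAt q := by
      funext ξ; simp [symbolAt]
    rw [this]; exact hp.add hq
  | mul_X p i hp =>
    have : symbolAt (p * MvPolynomial.X i) = symbolAt p * fun ξ => ((ξ i : ℝ) : ℂ) := by
      funext ξ; simp [symbolAt]
    rw [this]
    refine hp.mul ?_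
    exact ((Complex.ofRealCLM.comp (EuclideanSpace.proj i :
      EuclideanSpace ℝ (Fin n) →L[ℝ] ℝ)).hasTemperateGrowth)

/-- The symbol of `P(D)` in the variable of the Fourier transform. -/
noncomputable def fourierSymbol (P : MvPolynomial (Fin n) ℂ) (ξ : EuclideanSpace ℝ (Fin n)) : ℂ :=
  symbolAt P ((2 * Real.pi) • ξ)

lemma hasTemperateGrowth_fourierSymbol (P : MvPolynomial (Fin n) ℂ) :
    Function.HasTemperateGrowth (fourierSymbol P) :=
  (hasTemperateGrowth_symbolAt P).comp
    (((2 * Real.pi) • ContinuousLinearMap.id ℝ (EuclideanSpace ℝ (Fin n))).hasTemperateGrowth)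

/-- The operator `P(D)` on Schwartz functions. -/
noncomputable def polyOp (P : MvPolynomial (Fin n) ℂ) : Schwartz n →L[ℂ] Schwartz n :=
  SchwartzMap.fourierMultiplierCLM ℂ (fourierSymbol P)

lemma polyOp_mul (P R : MvPolynomial (Fin n) ℂ) (w : Schwartz n) :
    polyOp (P * R) w = polyOp P (polyOp R w) := by
  rw [polyOp, polyOp, polyOp, SchwartzMap.fourierMultiplierCLM_fourierMultiplierCLM_apply
    (hasTemperateGrowth_fourierSymbol P) (hasTemperateGrowth_fourierSymbol R)]
  congr 2
  funext ξ
  exact symbolAt_mul P R _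

lemma polyOp_add (P R : MvPolynomial (Fin n) ℂ) (w : Schwartz n) :
    polyOp (P + R) w = polyOp P w + polyOp R w := by
  have : fourierSymbol (P + R) = fourierSymbol P + fourierSymbol R := by
    funext ξ; exact symbolAt_add P R _
  simp only [polyOp, SchwartzMap.fourierMultiplierCLM_apply]
  rw [this, SchwartzMap.smulLeftCLM_add (hasTemperateGrowth_fourierSymbol P)
    (hasTemperateGrowth_fourierSymbol R), add_apply, FourierTransform.fourierInv_add]

lemma polyOp_C (a : ℂ) (w : Schwartz n) : polyOp (MvPolynomial.C a) w = a • w := by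
  have : fourierSymbol (MvPolynomial.C a : MvPolynomial (Fin n) ℂ) = fun _ => a := by
    funext ξ; simp [fourierSymbol, symbolAt]
  rw [polyOp, this, SchwartzMap.fourierMultiplierCLM_const]
  rfl

lemma polyOp_one (w : Schwartz n) : polyOp 1 w = w := by
  rw [← MvPolynomial.C_1, polyOp_C, one_smul]

lemma polyOp_X_apply (j : Fin n) (w : Schwartz n) (x : EuclideanSpace ℝ (Fin n)) :
    polyOp (MvPolynomial.X j) w x = partialD j w x := by
  have h := SchwartzMap.lineDeriv_eq_fourierMultiplierCLM
    (EuclideanSpace.single j (1 : ℝ)) w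
  have h1 : fourierSymbol (MvPolynomial.X j : MvPolynomial (Fin n) ℂ) = ((2 * Real.pi : ℝ) : ℂ) •
      (fun ξ => ((inner ℝ ξ (EuclideanSpace.single j (1 : ℝ)) : ℝ) : ℂ)) := by
    funext ξ
    simp [fourierSymbol, symbolAt, EuclideanSpace.inner_single_right]
  have hg : Function.HasTemperateGrowth
      (fun ξ : EuclideanSpace ℝ (Fin n) => inner ℝ ξ (EuclideanSpace.single j (1 : ℝ))) := by
    fun_prop
  have h3 : SchwartzMap.fourierMultiplierCLM ℂ (fun ξ : EuclideanSpace ℝ (Fin n) =>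
      ((inner ℝ ξ (EuclideanSpace.single j (1 : ℝ)) : ℝ) : ℂ)) w =
      SchwartzMap.fourierMultiplierCLM ℂ
        (fun ξ => inner ℝ ξ (EuclideanSpace.single j (1 : ℝ))) w :=
    SchwartzMap.fourierMultiplierCLM_ofReal ℂ hg w
  have h2 : polyOp (MvPolynomial.X j) w =
      (-Complex.I) • LineDeriv.lineDerivOp (EuclideanSpace.single j (1 : ℝ)) w := by
    rw [h, polyOp, h1, SchwartzMap.fourierMultiplierCLM_smul (by fun_prop),
      smul_apply, h3, smul_smul]
    congr 1
    push_cast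
    linear_combination (2 * Real.pi) * Complex.I_mul_I
  rw [h2, smul_apply, SchwartzMap.lineDerivOp_apply_eq_fderiv, partialD, smul_eq_mul]

lemma polyOp_X_coe (j : Fin n) (w : Schwartz n) :
    ⇑(polyOp (MvPolynomial.X j) w) = partialD j w := funext (polyOp_X_apply j w)

lemma polyOp_sum {ι : Type*} (s : Finset ι) (P : ι → MvPolynomial (Fin n) ℂ) (w : Schwartz n) :
    polyOp (∑ i ∈ s, P i) w = ∑ i ∈ s, polyOp (P i) w := by
  classical
  induction s using Finset.induction_on with
  | empty => simpa using polyOp_C (0 : ℂ) w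
  | insert i s hi ih => rw [Finset.sum_insert hi, Finset.sum_insert hi, polyOp_add, ih]

lemma multiD_coe (α : Fin n →₀ ℕ) (w : Schwartz n) :
    multiD α w = polyOp (MvPolynomial.monomial α 1) w := by
  have h1 : ∀ (j : Fin n) (k : ℕ) (v : Schwartz n),
      (partialD j)^[k] v = polyOp (MvPolynomial.X j ^ k) v := by
    intro j k v
    induction k with
    | zero => rw [pow_zero, polyOp_one]; rfl
    | succ k ih => rw [Function.iterate_succ_apply', ih, pow_succ', polyOp_mul, polyOp_X_coe]
  have h2 : ∀ L : List (Fin n), L.foldr (fun j v => (partialD j)^[α j] v) (⇑w)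
      = polyOp (L.map fun j => (MvPolynomial.X j : MvPolynomial (Fin n) ℂ) ^ α j).prod w := by
    intro L
    induction L with
    | nil => rw [List.map_nil, List.prod_nil, polyOp_one]; rfl
    | cons j L ih =>
      rw [List.foldr_cons, ih, List.map_cons, List.prod_cons, polyOp_mul, h1]
  rw [multiD, h2]
  congr 2
  rw [← List.ofFn_eq_map, List.prod_ofFn, MvPolynomial.monomial_eq, MvPolynomial.C_1, one_mul,
    Finsupp.prod_fintype _ _ (fun i => pow_zero _)]

lemma constCoeffOp_coe (Q : MvPolynomial (Fin n) ℂ) (w : Schwartz n) :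
    constCoeffOp Q w = polyOp Q w := by
  funext x
  conv_rhs => rw [Q.as_sum, polyOp_sum, sum_apply]
  refine Finset.sum_congr rfl fun α _ => ?_
  rw [multiD_coe, show MvPolynomial.monomial α (Q.coeff α) =
    MvPolynomial.C (Q.coeff α) * MvPolynomial.monomial α 1 by
      rw [MvPolynomial.C_mul_monomial, mul_one], polyOp_mul, polyOp_C, smul_apply, smul_eq_mul]

lemma constCoeffOp_iterate_coe (Q : MvPolynomial (Fin n) ℂ) (w : Schwartz n) (l : ℕ) :
    (constCoeffOp Q)^[l] w = polyOp (Q ^ l) w := by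
  induction l with
  | zero => rw [pow_zero, polyOp_one]; rfl
  | succ l ih => rw [Function.iterate_succ_apply', ih, pow_succ', polyOp_mul, constCoeffOp_coe]

section locality

variable {U : Set (EuclideanSpace ℝ (Fin n))} {u v : EuclideanSpace ℝ (Fin n) → ℂ}

lemma partialD_eqOn (hU : IsOpen U) (h : Set.EqOn u v U) (j : Fin n) :
    Set.EqOn (partialD j u) (partialD j v) U := by
  intro x hx
  rw [partialD, partialD, Filter.EventuallyEq.fderiv_eq
    (Filter.eventuallyEq_of_mem (hU.mem_nhds hx) h)]

lemma multiD_eqOn (hU : IsOpen U) (h : Set.EqOn u v U) (α : Fin n →₀ ℕ) :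
    Set.EqOn (multiD α u) (multiD α v) U := by
  have h1 : ∀ (j : Fin n) (k : ℕ) (u v : EuclideanSpace ℝ (Fin n) → ℂ), Set.EqOn u v U →
      Set.EqOn ((partialD j)^[k] u) ((partialD j)^[k] v) U := by
    intro j k
    induction k with
    | zero => exact fun u v h => h
    | succ k ih =>
      intro u v h
      rw [Function.iterate_succ_apply', Function.iterate_succ_apply']
      exact partialD_eqOn hU (ih u v h) j
  unfold multiD
  induction List.finRange n with
  | nil => exact h
  | cons j L ih => exact h1 j _ _ _ ih

lemma constCoeffOp_iterate_eqOn (hU : IsOpen U) (h : Set.EqOn u v U)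
    (Q : MvPolynomial (Fin n) ℂ) (l : ℕ) :
    Set.EqOn ((constCoeffOp Q)^[l] u) ((constCoeffOp Q)^[l] v) U := by
  induction l with
  | zero => exact h
  | succ l ih =>
    rw [Function.iterate_succ_apply', Function.iterate_succ_apply']
    intro x hx
    exact Finset.sum_congr rfl fun α _ => by rw [multiD_eqOn hU ih α hx]

/-- A Fourier multiplier is not visibly local; locality comes from identifying `polyOp` with the
differential operator `constCoeffOp`. -/
lemma polyOp_eqOn (hU : IsOpen U) {w z : Schwartz n} (h : Set.EqOn w z U)
    (P : MvPolynomial (Fin n) ℂ) : Set.EqOn (polyOp P w) (polyOp P z) U := by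
  rw [← constCoeffOp_coe, ← constCoeffOp_coe]
  exact constCoeffOp_iterate_eqOn hU h P 1

end locality

/-! ### The Leibniz formula -/

/-- The product of two Schwartz functions. -/
noncomputable def mulSchwartz (φ w : Schwartz n) : Schwartz n := SchwartzMap.smulLeftCLM ℂ φ w

lemma mulSchwartz_apply (φ w : Schwartz n) (x : EuclideanSpace ℝ (Fin n)) :
    mulSchwartz φ w x = φ x * w x := by
  rw [mulSchwartz, SchwartzMap.smulLeftCLM_apply_apply φ.hasTemperateGrowth, smul_eq_mul]

lemma polyOp_X_mulSchwartz (j : Fin n) (φ w : Schwartz n) :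
    polyOp (MvPolynomial.X j) (mulSchwartz φ w) =
      mulSchwartz (polyOp (MvPolynomial.X j) φ) w + mulSchwartz φ (polyOp (MvPolynomial.X j) w) := by
  ext x
  have e : ⇑(mulSchwartz φ w) = ⇑φ * ⇑w := funext (mulSchwartz_apply φ w)
  rw [add_apply, mulSchwartz_apply, mulSchwartz_apply]
  simp only [polyOp_X_apply, partialD]
  rw [e, fderiv_mul φ.differentiableAt w.differentiableAt]
  simp only [add_apply, smul_apply, smul_eq_mul]
  ring

/-- The bilinear expression `∑ D^β φ · c_β(D) w` attached to `∑ c_β(X) Y^β`. -/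
noncomputable def leibnizSum (φ w : Schwartz n)
    (S : MvPolynomial (Fin n) (MvPolynomial (Fin n) ℂ)) : Schwartz n :=
  ∑ β ∈ S.support, mulSchwartz (polyOp (MvPolynomial.monomial β 1) φ) (polyOp (S.coeff β) w)

lemma mulSchwartz_add (φ v w : Schwartz n) :
    mulSchwartz φ (v + w) = mulSchwartz φ v + mulSchwartz φ w := by
  rw [mulSchwartz, map_add]; rfl

lemma mulSchwartz_zero (φ : Schwartz n) : mulSchwartz φ 0 = 0 := by
  rw [mulSchwartz, map_zero]

lemma polyOp_zero (w : Schwartz n) : polyOp 0 w = 0 := by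
  rw [← MvPolynomial.C_0, polyOp_C, zero_smul]

lemma leibnizSum_eq_sum (φ w : Schwartz n) (S : MvPolynomial (Fin n) (MvPolynomial (Fin n) ℂ))
    {s : Finset (Fin n →₀ ℕ)} (hs : S.support ⊆ s) :
    leibnizSum φ w S =
      ∑ β ∈ s, mulSchwartz (polyOp (MvPolynomial.monomial β 1) φ) (polyOp (S.coeff β) w) := by
  refine Finset.sum_subset hs fun β _ hβ => ?_
  rw [MvPolynomial.notMem_support_iff.1 hβ, polyOp_zero, mulSchwartz_zero]

lemma leibnizSum_add (φ w : Schwartz n) (S T : MvPolynomial (Fin n) (MvPolynomial (Fin n) ℂ)) :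
    leibnizSum φ w (S + T) = leibnizSum φ w S + leibnizSum φ w T := by
  classical
  rw [leibnizSum_eq_sum φ w (S + T) MvPolynomial.support_add,
    leibnizSum_eq_sum φ w S Finset.subset_union_left,
    leibnizSum_eq_sum φ w T Finset.subset_union_right, ← Finset.sum_add_distrib]
  refine Finset.sum_congr rfl fun β _ => ?_
  rw [MvPolynomial.coeff_add, polyOp_add, mulSchwartz_add]

lemma leibnizSum_monomial (φ w : Schwartz n) (β : Fin n →₀ ℕ) (c : MvPolynomial (Fin n) ℂ) :
    leibnizSum φ w (MvPolynomial.monomial β c) =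
      mulSchwartz (polyOp (MvPolynomial.monomial β 1) φ) (polyOp c w) := by
  rw [leibnizSum_eq_sum φ w _ MvPolynomial.support_monomial_subset, Finset.sum_singleton,
    MvPolynomial.coeff_monomial, if_pos rfl]

/-- This is the product rule in symbolic form: the outer variable `X j` records a derivative falling
on `φ`, the coefficient `C (X j)` one falling on `w`. Their sum is the image of `X j` under
`taylorHom`. -/
lemma polyOp_X_leibnizSum (φ w : Schwartz n) (j : Fin n)
    (S : MvPolynomial (Fin n) (MvPolynomial (Fin n) ℂ)) :
    polyOp (MvPolynomial.X j) (leibnizSum φ w S) =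
      leibnizSum φ w (S * (MvPolynomial.X j + MvPolynomial.C (MvPolynomial.X j))) := by
  induction S using MvPolynomial.induction_on' with
  | monomial β c =>
    have e1 : MvPolynomial.monomial β c * MvPolynomial.X j =
        MvPolynomial.monomial (β + Finsupp.single j 1) c := by
      rw [MvPolynomial.X, MvPolynomial.monomial_mul, mul_one]
    have e2 : (MvPolynomial.X j * MvPolynomial.monomial β 1 : MvPolynomial (Fin n) ℂ) =
        MvPolynomial.monomial (β + Finsupp.single j 1) 1 := by
      rw [mul_comm, MvPolynomial.X, MvPolynomial.monomial_mul, mul_one]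
    rw [mul_add, leibnizSum_add, e1, mul_comm _ (MvPolynomial.C _), MvPolynomial.C_mul_monomial,
      leibnizSum_monomial, leibnizSum_monomial, leibnizSum_monomial, polyOp_X_mulSchwartz,
      ← polyOp_mul, ← polyOp_mul, e2]
  | add p q hp hq => rw [leibnizSum_add, map_add, hp, hq, add_mul, leibnizSum_add]

/-- The Leibniz formula for constant coefficient operators. -/
lemma polyOp_mulSchwartz (P : MvPolynomial (Fin n) ℂ) (φ w : Schwartz n) :
    polyOp P (mulSchwartz φ w) = ∑ β ∈ (MvPolynomial.taylorHom n P).support,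
      mulSchwartz (polyOp (MvPolynomial.monomial β 1) φ) (polyOp (MvPolynomial.hasse β P) w) := by
  change _ = leibnizSum φ w (MvPolynomial.taylorHom n P)
  induction P using MvPolynomial.induction_on with
  | C a =>
    rw [MvPolynomial.taylorHom_C,
      show MvPolynomial.C (MvPolynomial.C a) = MvPolynomial.monomial 0 (MvPolynomial.C a) from rfl,
      leibnizSum_monomial, polyOp_C,
      polyOp_C]
    have : (MvPolynomial.monomial 0 1 : MvPolynomial (Fin n) ℂ) = 1 := rfl
    rw [this, polyOp_one, mulSchwartz, mulSchwartz, map_smul]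
  | add p q hp hq => rw [polyOp_add, map_add, leibnizSum_add, hp, hq]
  | mul_X p j hp =>
    rw [mul_comm, polyOp_mul, hp, polyOp_X_leibnizSum, mul_comm, map_mul, MvPolynomial.taylorHom_X]

end operators

/-! ### Local and global `L²` norms -/

section norms

variable {n : ℕ}

/-- The `L²` norm on a set. -/
noncomputable def l2On (S : Set (EuclideanSpace ℝ (Fin n))) (w : Schwartz n) : ℝ :=
  (eLpNorm w 2 (volume.restrict S)).toReal

lemma memLp_restrict (S : Set (EuclideanSpace ℝ (Fin n))) (w : Schwartz n) :
    MemLp w 2 (volume.restrict S) := (w.memLp 2 volume).restrict S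

lemma ofReal_l2On (S : Set (EuclideanSpace ℝ (Fin n))) (w : Schwartz n) :
    ENNReal.ofReal (l2On S w) = eLpNorm w 2 (volume.restrict S) :=
  ENNReal.ofReal_toReal (memLp_restrict S w).eLpNorm_ne_top

lemma l2On_nonneg (S : Set (EuclideanSpace ℝ (Fin n))) (w : Schwartz n) : 0 ≤ l2On S w :=
  ENNReal.toReal_nonneg

lemma l2On_add_le (S : Set (EuclideanSpace ℝ (Fin n))) (v w : Schwartz n) :
    l2On S (v + w) ≤ l2On S v + l2On S w := by
  rw [l2On, l2On, l2On, ← ENNReal.toReal_add (memLp_restrict S v).eLpNorm_ne_top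
    (memLp_restrict S w).eLpNorm_ne_top]
  refine ENNReal.toReal_mono (ENNReal.add_ne_top.2 ⟨(memLp_restrict S v).eLpNorm_ne_top,
    (memLp_restrict S w).eLpNorm_ne_top⟩) ?_
  exact eLpNorm_add_le (memLp_restrict S v).1 (memLp_restrict S w).1 (by norm_num)

lemma l2On_zero (S : Set (EuclideanSpace ℝ (Fin n))) : l2On S 0 = 0 := by
  have : ⇑(0 : Schwartz n) = 0 := rfl
  rw [l2On, this, eLpNorm_zero, ENNReal.toReal_zero]

lemma l2On_sum_le (S : Set (EuclideanSpace ℝ (Fin n))) {ι : Type*} (s : Finset ι)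
    (w : ι → Schwartz n) : l2On S (∑ i ∈ s, w i) ≤ ∑ i ∈ s, l2On S (w i) :=
  Finset.le_sum_of_subadditive _ (l2On_zero S).le (l2On_add_le S) s w

lemma l2On_mono {S T : Set (EuclideanSpace ℝ (Fin n))} (h : S ⊆ T) (w : Schwartz n) :
    l2On S w ≤ l2On T w :=
  ENNReal.toReal_mono (memLp_restrict T w).eLpNorm_ne_top
    (eLpNorm_mono_measure _ (Measure.restrict_mono h le_rfl))

lemma l2On_congr {S : Set (EuclideanSpace ℝ (Fin n))} (hS : MeasurableSet S) {v w : Schwartz n}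
    (h : Set.EqOn v w S) : l2On S v = l2On S w := by
  rw [l2On, l2On, eLpNorm_congr_ae ((ae_restrict_iff' hS).2 (Filter.Eventually.of_forall h))]

lemma l2On_mulSchwartz_le {T : Set (EuclideanSpace ℝ (Fin n))} (hT : MeasurableSet T)
    {φ : Schwartz n} {B : ℝ} (hB : 0 ≤ B) (h1 : ∀ x, ‖φ x‖ ≤ B) (h2 : ∀ x ∉ T, φ x = 0)
    (w : Schwartz n) : l2On Set.univ (mulSchwartz φ w) ≤ B * l2On T w := by
  have h : eLpNorm (mulSchwartz φ w) 2 volume ≤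
      ENNReal.ofReal B * eLpNorm (T.indicator w) 2 volume := by
    refine eLpNorm_le_mul_eLpNorm_of_ae_le_mul (Filter.Eventually.of_forall fun x => ?_) 2
    rw [mulSchwartz_apply, norm_mul]
    by_cases hx : x ∈ T
    · rw [Set.indicator_of_mem hx]
      gcongr
      exact h1 x
    · rw [h2 x hx, norm_zero, zero_mul]
      positivity
  rw [eLpNorm_indicator_eq_eLpNorm_restrict hT] at h
  rw [l2On, l2On, Measure.restrict_univ]
  refine (ENNReal.toReal_mono ?_ h).trans ?_
  · exact ENNReal.mul_ne_top ENNReal.ofReal_ne_top (memLp_restrict T w).eLpNorm_ne_top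
  · rw [ENNReal.toReal_mul, ENNReal.toReal_ofReal hB]

/-- Pointwise domination of symbols gives domination of operators. -/
lemma l2On_univ_polyOp_le {P R : MvPolynomial (Fin n) ℂ} {a b : ℝ} (ha : 0 ≤ a) (hb : 0 ≤ b)
    (h : ∀ ξ, ‖symbolAt P ξ‖ ≤ a * ‖symbolAt R ξ‖ + b) (w : Schwartz n) :
    l2On Set.univ (polyOp P w) ≤ a * l2On Set.univ (polyOp R w) + b * l2On Set.univ w := by
  -- Plancherel, after which the operators are multiplications by their symbols.
  have hF : ∀ v : Schwartz n, eLpNorm v 2 volume =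
      eLpNorm (FourierTransform.fourier v : Schwartz n) 2 volume := by
    intro v
    have := SchwartzMap.norm_fourier_toL2_eq v
    rw [SchwartzMap.norm_toLp, SchwartzMap.norm_toLp] at this
    exact ((ENNReal.toReal_eq_toReal_iff' (SchwartzMap.memLp _ 2 volume).eLpNorm_ne_top
      (v.memLp 2 volume).eLpNorm_ne_top).1 this).symm
  have hP : ∀ (P : MvPolynomial (Fin n) ℂ) (ξ : EuclideanSpace ℝ (Fin n)),
      (FourierTransform.fourier (polyOp P w) : Schwartz n) ξ =
        fourierSymbol P ξ * (FourierTransform.fourier w : Schwartz n) ξ := by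
    intro P ξ
    rw [polyOp, SchwartzMap.fourierMultiplierCLM_apply, FourierTransform.fourier_fourierInv_eq,
      SchwartzMap.smulLeftCLM_apply_apply (hasTemperateGrowth_fourierSymbol P), smul_eq_mul]
  set f : Schwartz n := FourierTransform.fourier (polyOp R w)
  set g : Schwartz n := FourierTransform.fourier w
  have key : eLpNorm (polyOp P w) 2 volume ≤
      ENNReal.ofReal a * eLpNorm (polyOp R w) 2 volume + ENNReal.ofReal b * eLpNorm w 2 volume := by
    rw [hF (polyOp P w), hF (polyOp R w), hF w]
    have e1 : ∀ (c : ℝ), 0 ≤ c → ∀ v : Schwartz n,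
        eLpNorm (fun ξ => c * ‖v ξ‖) 2 volume = ENNReal.ofReal c * eLpNorm v 2 volume := by
      intro c hc v
      have := eLpNorm_const_smul c (fun ξ => ‖v ξ‖) 2 volume
      rw [eLpNorm_norm, Real.enorm_eq_ofReal hc] at this
      exact this
    rw [← e1 a ha, ← e1 b hb]
    refine le_trans ?_ (eLpNorm_add_le (by fun_prop) (by fun_prop) (by norm_num))
    refine eLpNorm_mono fun ξ => ?_
    rw [hP, norm_mul, Pi.add_apply, Real.norm_of_nonneg (by positivity), hP, norm_mul]
    calc ‖fourierSymbol P ξ‖ * ‖g ξ‖ ≤ (a * ‖fourierSymbol R ξ‖ + b) * ‖g ξ‖ := by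
          gcongr; exact h _
      _ = _ := by ring
  rw [l2On, l2On, l2On, Measure.restrict_univ]
  have t1 := (SchwartzMap.memLp (polyOp R w) 2 volume).eLpNorm_ne_top
  have t2 := (SchwartzMap.memLp w 2 volume).eLpNorm_ne_top
  have t3 := ENNReal.mul_ne_top (ENNReal.ofReal_ne_top (r := a)) t1
  have t4 := ENNReal.mul_ne_top (ENNReal.ofReal_ne_top (r := b)) t2
  refine (ENNReal.toReal_mono (ENNReal.add_ne_top.2 ⟨t3, t4⟩) key).trans ?_
  rw [ENNReal.toReal_add t3 t4, ENNReal.toReal_mul, ENNReal.toReal_mul, ENNReal.toReal_ofReal ha,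
    ENNReal.toReal_ofReal hb]

end norms

/-! ### Cutoffs between cubes -/

section cutoff

variable {n : ℕ}

/-- The open cube of centre `c` and half side `r`. -/
def cube (c : EuclideanSpace ℝ (Fin n)) (r : ℝ) : Set (EuclideanSpace ℝ (Fin n)) :=
  {x | ∀ i, |x i - c i| < r}

lemma cube_mono (c : EuclideanSpace ℝ (Fin n)) {r s : ℝ} (h : r ≤ s) : cube c r ⊆ cube c s :=
  fun _ hx i => (hx i).trans_le h

lemma isOpen_cube (c : EuclideanSpace ℝ (Fin n)) (r : ℝ) : IsOpen (cube c r) := by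
  have : cube c r = ⋂ i, {x | |x i - c i| < r} := by ext; simp [cube]
  rw [this]
  exact isOpen_iInter_of_finite fun i => isOpen_lt (by fun_prop) continuous_const

lemma measurableSet_cube (c : EuclideanSpace ℝ (Fin n)) (r : ℝ) : MeasurableSet (cube c r) :=
  (isOpen_cube c r).measurableSet

lemma isCompact_closedCube (c : EuclideanSpace ℝ (Fin n)) (r : ℝ) :
    IsCompact {x : EuclideanSpace ℝ (Fin n) | ∀ i, |x i - c i| ≤ r} := by
  have h := (EuclideanSpace.equiv (Fin n) ℝ).toHomeomorph.isCompact_preimage.2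
    (isCompact_univ_pi fun i => isCompact_Icc (a := c i - r) (b := c i + r))
  convert h using 1
  ext x
  simp only [Set.mem_ofPred_eq, Set.mem_preimage, Set.mem_pi, Set.mem_univ, true_imp_iff,
    Set.mem_Icc, abs_le]
  refine forall_congr' fun i => ⟨fun h => ⟨?_, ?_⟩, fun h => ⟨?_, ?_⟩⟩
  · change c i - r ≤ x i; linarith [h.1]
  · change x i ≤ c i + r; linarith [h.2]
  · have : c i - r ≤ x i := h.1
    linarith
  · have : x i ≤ c i + r := h.2
    linarith

lemma exists_cube_subset {U : Set (EuclideanSpace ℝ (Fin n))} (hU : IsOpen U)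
    {c : EuclideanSpace ℝ (Fin n)} (hc : c ∈ U) : ∃ r : ℝ, 0 < r ∧ cube c r ⊆ U := by
  let e := (EuclideanSpace.equiv (Fin n) ℝ).toHomeomorph
  have hV : IsOpen (e.symm ⁻¹' U) := hU.preimage e.symm.continuous
  obtain ⟨r, hr, h⟩ := Metric.isOpen_iff.1 hV (e c) (by simpa using hc)
  refine ⟨r, hr, fun x hx => ?_⟩
  have hx' : e x ∈ Metric.ball (e c) r := by
    rw [Metric.mem_ball, dist_pi_lt_iff hr]
    exact hx
  simpa using h hx'

/-- Derivatives of a product of functions of one variable. -/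
lemma polyOp_monomial_prod {f : ℝ → ℝ} (hf : ContDiff ℝ ∞ f) (c : EuclideanSpace ℝ (Fin n))
    {φ : Schwartz n} (hφ : ∀ x, φ x = ∏ i, (f (x i - c i) : ℂ)) (β : Fin n →₀ ℕ)
    (x : EuclideanSpace ℝ (Fin n)) :
    polyOp (MvPolynomial.monomial β 1) φ x =
      ∏ i, (-Complex.I) ^ β i * ((iteratedDeriv (β i) f (x i - c i) : ℝ) : ℂ) := by
  -- One derivative `D_j` is removed at a time; along the line in direction `j` only the `j`-th
  -- factor varies.
  induction h : β.degree generalizing β x with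
  | zero =>
    obtain rfl := (Finsupp.degree_eq_zero_iff β).1 h
    rw [show (MvPolynomial.monomial 0 1 : MvPolynomial (Fin n) ℂ) = 1 from rfl, polyOp_one, hφ]
    simp
  | succ k ih =>
    obtain ⟨j, hj⟩ : ∃ j, β j ≠ 0 := by
      by_contra! hne
      have : β = 0 := Finsupp.ext hne
      simp [this] at h
    obtain ⟨γ, rfl⟩ : ∃ γ, β = γ + Finsupp.single j 1 :=
      ⟨β - Finsupp.single j 1, (tsub_add_cancel_of_le (by
        rw [Finsupp.single_le_iff]; omega)).symm⟩
    have hγ : γ.degree = k := by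
      rw [map_add, Finsupp.degree_single] at h; omega
    have e : (MvPolynomial.monomial (γ + Finsupp.single j 1) 1 : MvPolynomial (Fin n) ℂ) =
        MvPolynomial.X j * MvPolynomial.monomial γ 1 := by
      rw [mul_comm, MvPolynomial.X, MvPolynomial.monomial_mul, mul_one]
    rw [e, polyOp_mul, polyOp_X_apply, partialD]
    set ψ := polyOp (MvPolynomial.monomial γ 1) φ with hψ
    have h1 : fderiv ℝ ψ x (EuclideanSpace.single j 1) =
        deriv (fun t : ℝ => ψ (x + t • EuclideanSpace.single j 1)) 0 := by
      rw [← ψ.differentiableAt.lineDeriv_eq_fderiv, lineDeriv]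
    have h2 : (fun t : ℝ => ψ (x + t • EuclideanSpace.single j 1)) = fun t =>
        ((-Complex.I) ^ γ j * ((iteratedDeriv (γ j) f (t + (x j - c j)) : ℝ) : ℂ)) *
        ∏ i ∈ Finset.univ.erase j,
          (-Complex.I) ^ γ i * ((iteratedDeriv (γ i) f (x i - c i) : ℝ) : ℂ) := by
      funext t
      rw [ih γ _ hγ, ← Finset.mul_prod_erase _ _ (Finset.mem_univ j)]
      congr 1
      · simp only [PiLp.add_apply, PiLp.smul_apply, PiLp.single_apply, if_true,
          smul_eq_mul, mul_one]
        congr 3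
        ring
      · refine Finset.prod_congr rfl fun i hi => ?_
        simp [(Finset.mem_erase.1 hi).1]
    have h3 : HasDerivAt (fun t : ℝ => ((iteratedDeriv (γ j) f (t + (x j - c j)) : ℝ) : ℂ))
        ((iteratedDeriv (γ j + 1) f (x j - c j) : ℝ) : ℂ) 0 := by
      have h4 : HasDerivAt (iteratedDeriv (γ j) f) (iteratedDeriv (γ j + 1) f (0 + (x j - c j)))
          (0 + (x j - c j)) := by
        rw [iteratedDeriv_succ]
        exact (hf.differentiable_iteratedDeriv (γ j) (by exact_mod_cast ENat.natCast_lt_top _)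
          _).hasDerivAt
      have := (h4.comp_add_const 0 (x j - c j)).ofReal_comp
      rwa [zero_add] at this
    rw [h1, h2, ((h3.const_mul _).mul_const _).deriv, ← Finset.mul_prod_erase _ _
      (Finset.mem_univ j), ← mul_assoc]
    congr 1
    · simp only [Finsupp.add_apply, Finsupp.single_eq_same, pow_succ]
      ring
    · refine Finset.prod_congr rfl fun i hi => ?_
      simp [(Finset.mem_erase.1 hi).1]

/-- Cutoff functions between concentric cubes, with geometric bounds on `N` derivatives. -/
lemma exists_cutoff (c : EuclideanSpace ℝ (Fin n)) {r δ : ℝ} (hr : 0 ≤ r) (hδ : 0 < δ) {N : ℕ}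
    (hN : 1 ≤ N) : ∃ φ : Schwartz n, (∀ x ∈ cube c r, φ x = 1) ∧
      ∀ β : Fin n →₀ ℕ, β.degree ≤ N →
        (∀ x, ‖polyOp (MvPolynomial.monomial β 1) φ x‖ ≤ (8 * N / δ) ^ β.degree) ∧
        ∀ x ∉ cube c (r + δ), polyOp (MvPolynomial.monomial β 1) φ x = 0 := by
  -- Using `δ/2` turns the constant `4` into `8` and makes the cutoff vanish on a neighbourhood of
  -- every point outside the larger cube, so its derivatives vanish there too.
  obtain ⟨f, hf, h1, h0, hb⟩ := exists_cutoff_real hr (half_pos hδ) hN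
  let F : EuclideanSpace ℝ (Fin n) → ℂ := fun x => ∏ i, (f (x i - c i) : ℂ)
  have hF0 : ∀ x i, r + δ / 2 ≤ |x i - c i| → F x = 0 := fun x i hx =>
    Finset.prod_eq_zero (Finset.mem_univ i) (by rw [h0 _ hx, Complex.ofReal_zero])
  have hFc : HasCompactSupport F := by
    refine HasCompactSupport.intro (isCompact_closedCube c (r + δ / 2)) fun x hx => ?_
    simp only [Set.mem_ofPred_eq, not_forall, not_le] at hx
    obtain ⟨i, hi⟩ := hx
    exact hF0 x i hi.le
  have hFs : ContDiff ℝ ∞ F := by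
    refine contDiff_prod fun i _ => ?_
    refine Complex.ofRealCLM.contDiff.comp (hf.comp ?_)
    fun_prop
  let φ : Schwartz n := hFc.toSchwartzMap hFs
  have hφ : ∀ x, φ x = ∏ i, (f (x i - c i) : ℂ) := fun x => rfl
  refine ⟨φ, fun x hx => ?_, fun β hβ => ⟨fun x => ?_, fun x hx => ?_⟩⟩
  · rw [hφ]
    exact Finset.prod_eq_one fun i _ => by rw [h1 _ (hx i).le, Complex.ofReal_one]
  · rw [polyOp_monomial_prod hf c hφ, norm_prod, Finsupp.degree_eq_sum,
      ← Finset.prod_pow_eq_pow_sum]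
    refine Finset.prod_le_prod (fun _ _ => norm_nonneg _) fun i _ => ?_
    rw [norm_mul, norm_pow, norm_neg, Complex.norm_I, one_pow, one_mul, Complex.norm_real,
      Real.norm_eq_abs]
    refine (hb (β i) ((Finsupp.le_degree i β).trans hβ) _).trans (le_of_eq ?_)
    congr 1
    field_simp
    ring
  · simp only [cube, Set.mem_ofPred_eq, not_forall, not_lt] at hx
    obtain ⟨i, hi⟩ := hx
    have hV : IsOpen {x : EuclideanSpace ℝ (Fin n) | r + δ / 2 < |x i - c i|} :=
      isOpen_lt continuous_const (by fun_prop)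
    have := polyOp_eqOn hV (w := φ) (z := 0) (fun y hy => hF0 y i (le_of_lt hy))
      (MvPolynomial.monomial β 1) (show r + δ / 2 < |x i - c i| by linarith)
    rw [this, map_zero]
    rfl

end cutoff

/-! ### The interior estimate at scale `1/t` -/

/-- Absorption of the error term by iterating over shrinking scales. -/
lemma le_of_scale_iteration {G : ℝ → ℝ → ℝ} {s θ B E₁ E₂ G₀ R : ℝ} (hs : 0 ≤ s) (hθ : 0 ≤ θ)
    (hθs : θ * 2 ^ s ≤ 1 / 2) (hB : 0 ≤ B) (hE₁ : 0 ≤ E₁) (hE₂ : 0 ≤ E₂) (hG₀ : 0 ≤ G₀)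
    (hstep : ∀ r t, 0 ≤ r → 1 ≤ t → r + 1 / t ≤ R →
      G r t ≤ θ * G (r + 1 / t) t + B * (E₁ + t ^ s * E₂))
    (hdouble : ∀ r t, 1 ≤ t → G r t ≤ G r (2 * t))
    (hbound : ∀ r t, r ≤ R → 1 ≤ t → G r t ≤ t ^ s * G₀)
    {r t : ℝ} (hr : 0 ≤ r) (ht : 1 ≤ t) (hrt : r + 2 / t ≤ R) :
    G r t ≤ 2 * B * 2 ^ s * (E₁ + t ^ s * E₂) := by
  have h2s : (1 : ℝ) ≤ 2 ^ s := Real.one_le_rpow (by norm_num) hs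
  -- Each round passes from `(r, t)` to `(r + 1/(2t), 2t)`. The new requirement `r + 3/(2t) ≤ R` is
  -- implied by the old one, and the a priori bound grows by `2^s` while `θ 2^s ≤ 1/2`, so the
  -- remainder halves.
  have claim : ∀ k : ℕ, ∀ r t, 0 ≤ r → 1 ≤ t → r + 2 / t ≤ R →
      G r t ≤ 2 * B * 2 ^ s * (E₁ + t ^ s * E₂) + (1 / 2) ^ k * (t ^ s * G₀) := by
    intro k
    induction k with
    | zero =>
      intro r t hr ht hrt
      have ht0 : 0 < t := by linarith
      have h1 : 0 ≤ t ^ s := by positivity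
      have h2 : r ≤ R := by
        have : 0 < 2 / t := by positivity
        linarith
      refine (hbound r t h2 ht).trans ?_
      rw [pow_zero, one_mul]
      exact le_add_of_nonneg_left (by positivity)
    | succ k ih =>
      intro r t hr ht hrt
      have ht0 : 0 < t := by linarith
      have e1 : 1 / (2 * t) = (1 / t) / 2 := by field_simp
      have e2 : 2 / (2 * t) = 1 / t := by field_simp
      have e3 : 2 / t = 2 * (1 / t) := by ring
      have hpos : 0 < 1 / t := by positivity
      have hst := hstep r (2 * t) hr (by linarith) (by rw [e1]; linarith)
      have hih := ih (r + 1 / (2 * t)) (2 * t) (by positivity) (by linarith)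
        (by rw [e1, e2]; linarith)
      have e4 : (2 * t) ^ s = 2 ^ s * t ^ s := Real.mul_rpow (by norm_num) ht0.le
      have hts : 0 ≤ t ^ s := by positivity
      set X := E₁ + t ^ s * E₂ with hX
      have hX0 : 0 ≤ X := by positivity
      have h5 : E₁ + (2 * t) ^ s * E₂ ≤ 2 ^ s * X := by
        rw [e4, hX]
        nlinarith
      calc G r t ≤ G r (2 * t) := hdouble r t ht
        _ ≤ _ := hst
        _ ≤ θ * (2 * B * 2 ^ s * (E₁ + (2 * t) ^ s * E₂) + (1 / 2) ^ k * ((2 * t) ^ s * G₀)) +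
            B * (E₁ + (2 * t) ^ s * E₂) := by gcongr
        _ ≤ θ * (2 * B * 2 ^ s * (2 ^ s * X) + (1 / 2) ^ k * ((2 * t) ^ s * G₀)) +
            B * (2 ^ s * X) := by gcongr
        _ = (θ * 2 ^ s) * (2 * B * 2 ^ s * X + (1 / 2) ^ k * (t ^ s * G₀)) +
            B * 2 ^ s * X := by rw [e4]; ring
        _ ≤ (1 / 2) * (2 * B * 2 ^ s * X + (1 / 2) ^ k * (t ^ s * G₀)) + B * 2 ^ s * X := by
            gcongr
        _ = _ := by ring
  have hlim : Filter.Tendsto (fun k : ℕ => 2 * B * 2 ^ s * (E₁ + t ^ s * E₂) +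
      (1 / 2 : ℝ) ^ k * (t ^ s * G₀)) Filter.atTop
      (nhds (2 * B * 2 ^ s * (E₁ + t ^ s * E₂) + 0 * (t ^ s * G₀))) :=
    tendsto_const_nhds.add ((tendsto_pow_atTop_nhds_zero_of_lt_one (by norm_num)
      (by norm_num)).mul_const _)
  rw [zero_mul, add_zero] at hlim
  exact ge_of_tendsto' hlim fun k => claim k r t hr ht hrt

section interior

open MvPolynomial (hasse taylorHom)

variable {n : ℕ}

/-- The weighted sum of the lower order terms `Q^{(β)}(D) w`. -/
noncomputable def lowerTerms (Q : MvPolynomial (Fin n) ℂ) (c : EuclideanSpace ℝ (Fin n))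
    (w : Schwartz n) (r t : ℝ) : ℝ :=
  ∑ β ∈ (taylorHom n Q).support.erase 0, t ^ β.degree * l2On (cube c r) (polyOp (hasse β Q) w)

lemma degree_le_of_mem_support_taylorHom {Q : MvPolynomial (Fin n) ℂ} {β : Fin n →₀ ℕ}
    (h : β ∈ (taylorHom n Q).support) : β.degree ≤ Q.totalDegree :=
  MvPolynomial.degree_le_of_hasse_ne_zero (MvPolynomial.mem_support_iff.1 h)

lemma zero_mem_support_taylorHom {Q : MvPolynomial (Fin n) ℂ} (hQ : 1 ≤ Q.totalDegree) :
    0 ∈ (taylorHom n Q).support := by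
  rw [MvPolynomial.mem_support_iff]
  change hasse 0 Q ≠ 0
  rw [MvPolynomial.hasse_zero]
  rintro rfl
  simp at hQ

/-- With a cutoff of width `1/t`, the term `β = 0` of the Leibniz formula gives `Q(D) w`. In the
others `D^β φ` has size at most `(8 m t)^|β|`, which is the weight in `lowerTerms` up to a constant.
-/
lemma exists_cutoff_leibniz {Q : MvPolynomial (Fin n) ℂ} (hQ : 1 ≤ Q.totalDegree)
    (c : EuclideanSpace ℝ (Fin n)) (w : Schwartz n) {r t : ℝ} (hr : 0 ≤ r) (ht : 1 ≤ t) :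
    ∃ φ : Schwartz n, (∀ x ∈ cube c r, φ x = 1) ∧
      l2On Set.univ (mulSchwartz φ w) ≤ l2On (cube c (r + 1 / t)) w ∧
      l2On Set.univ (polyOp Q (mulSchwartz φ w)) ≤ l2On (cube c (r + 1 / t)) (polyOp Q w) +
        (8 * Q.totalDegree) ^ Q.totalDegree * lowerTerms Q c w (r + 1 / t) t := by
  have ht0 : 0 < t := by linarith
  obtain ⟨φ, hφ1, hφ⟩ := exists_cutoff c hr (δ := 1 / t) (by positivity) hQ
  set m := Q.totalDegree with hm
  have hm1 : (1 : ℝ) ≤ m := by exact_mod_cast hQ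
  have hterm : ∀ β : Fin n →₀ ℕ, β.degree ≤ m → ∀ v : Schwartz n,
      l2On Set.univ (mulSchwartz (polyOp (MvPolynomial.monomial β 1) φ) v) ≤
        (8 * m / (1 / t)) ^ β.degree * l2On (cube c (r + 1 / t)) v := fun β hβ v =>
    l2On_mulSchwartz_le (measurableSet_cube _ _) (by positivity) (hφ β hβ).1 (hφ β hβ).2 v
  have hone : (MvPolynomial.monomial 0 1 : MvPolynomial (Fin n) ℂ) = 1 := rfl
  have h0 : ∀ v : Schwartz n, l2On Set.univ (mulSchwartz φ v) ≤ l2On (cube c (r + 1 / t)) v := by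
    intro v
    have := hterm 0 (by simp) v
    rwa [hone, polyOp_one, map_zero, pow_zero, one_mul] at this
  refine ⟨φ, hφ1, h0 w, ?_⟩
  rw [polyOp_mulSchwartz, ← Finset.add_sum_erase _ _ (zero_mem_support_taylorHom hQ), hone,
    polyOp_one, MvPolynomial.hasse_zero]
  refine (l2On_add_le _ _ _).trans (add_le_add (h0 _) ((l2On_sum_le _ _ _).trans ?_))
  rw [lowerTerms, Finset.mul_sum]
  refine Finset.sum_le_sum fun β hβ => ?_
  have hβm : β.degree ≤ m := degree_le_of_mem_support_taylorHom (Finset.mem_of_mem_erase hβ)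
  refine (hterm β hβm _).trans ?_
  rw [← mul_assoc]
  refine mul_le_mul_of_nonneg_right ?_ (l2On_nonneg _ _)
  rw [div_div_eq_mul_div, div_one, mul_pow]
  gcongr
  linarith

lemma lowerTerms_le_double (Q : MvPolynomial (Fin n) ℂ) (c : EuclideanSpace ℝ (Fin n))
    (w : Schwartz n) (r : ℝ) {t : ℝ} (ht : 1 ≤ t) :
    lowerTerms Q c w r t ≤ lowerTerms Q c w r (2 * t) := by
  refine Finset.sum_le_sum fun β _ => mul_le_mul_of_nonneg_right ?_ (l2On_nonneg _ _)
  gcongr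
  linarith

/-- The a priori bound that starts the absorption: the sum may depend on `w` in any way, since it
disappears in the limit. -/
lemma lowerTerms_le_rpow_mul (Q : MvPolynomial (Fin n) ℂ) (c : EuclideanSpace ℝ (Fin n))
    (w : Schwartz n) {r R t s : ℝ} (hr : r ≤ R) (ht : 1 ≤ t) (hs : Q.totalDegree ≤ s) :
    lowerTerms Q c w r t ≤
      t ^ s * ∑ β ∈ (taylorHom n Q).support.erase 0, l2On (cube c R) (polyOp (hasse β Q) w) := by
  rw [lowerTerms, Finset.mul_sum]
  refine Finset.sum_le_sum fun β hβ => ?_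
  have h1 : t ^ β.degree ≤ t ^ s := by
    rw [← Real.rpow_natCast]
    refine Real.rpow_le_rpow_of_exponent_le ht (le_trans ?_ hs)
    exact_mod_cast degree_le_of_mem_support_taylorHom (Finset.mem_of_mem_erase hβ)
  exact mul_le_mul h1 (l2On_mono (cube_mono c hr) _) (l2On_nonneg _ _) (by positivity)

/-- One step of the absorption argument for the lower order terms. -/
lemma lowerTerms_step {Q : MvPolynomial (Fin n) ℂ} (hQ : 1 ≤ Q.totalDegree) {C s κ : ℝ}
    (hC : 1 ≤ C) (hs0 : 0 ≤ s) (hκ1 : 1 ≤ κ)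
    (hSE : ∀ β ∈ (taylorHom n Q).support, ∀ t : ℝ, 1 ≤ t → ∀ ξ,
      t ^ β.degree * ‖symbolAt (hasse β Q) ξ‖ ≤ C * (‖symbolAt Q ξ‖ + t ^ s))
    (c : EuclideanSpace ℝ (Fin n)) (w : Schwartz n) {R r t : ℝ} (hr : 0 ≤ r) (ht : 1 ≤ t)
    (hR : r + 1 / t ≤ R) :
    lowerTerms Q c w r t ≤
      ((taylorHom n Q).support.card * C * (8 * Q.totalDegree) ^ Q.totalDegree / κ) *
        lowerTerms Q c w (r + 1 / t) t +
      ((taylorHom n Q).support.card * C * κ ^ s) *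
        (l2On (cube c R) (polyOp Q w) + t ^ s * l2On (cube c R) w) := by
  set S := (taylorHom n Q).support with hS
  set m := Q.totalDegree with hm
  have hκ0 : 0 < κ := by linarith
  have hκs : 1 ≤ κ ^ s := Real.one_le_rpow hκ1 hs0
  set K : ℝ := S.card * C with hK
  have hK0 : 0 ≤ K := by positivity
  obtain ⟨φ, hφ1, hφw, hφQ⟩ := exists_cutoff_leibniz hQ c w hr ht
  have ht0 : 0 < t := by linarith
  set E₁ := l2On (cube c R) (polyOp Q w) with hE₁
  set E₂ := l2On (cube c R) w with hE₂
  have hE₁0 : 0 ≤ E₁ := l2On_nonneg _ _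
  have hE₂0 : 0 ≤ E₂ := l2On_nonneg _ _
  set G' := lowerTerms Q c w (r + 1 / t) t with hG'
  have hmono := cube_mono c hR
  have h1 : l2On Set.univ (polyOp Q (mulSchwartz φ w)) ≤ E₁ + (8 * m) ^ m * G' :=
    hφQ.trans (by gcongr; exact l2On_mono hmono _)
  have h2 : l2On Set.univ (mulSchwartz φ w) ≤ E₂ := hφw.trans (l2On_mono hmono _)
  have hκt : 1 ≤ κ * t := one_le_mul_of_one_le_of_one_le hκ1 ht
  set Y := E₁ + (8 * m) ^ m * G' + (κ * t) ^ s * E₂ with hY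
  -- The cutoff has scale `1/t`, but the symbol estimate is used at `κ t`. As `|β| ≥ 1`, this gains
  -- a factor `κ`, which will make the Leibniz error absorbable; the price is `κ^s` in front of
  -- `‖w‖`.
  have hterm : ∀ β ∈ S.erase 0,
      κ * (t ^ β.degree * l2On (cube c r) (polyOp (hasse β Q) w)) ≤ C * Y := by
    intro β hβ
    have hβS : β ∈ S := Finset.mem_of_mem_erase hβ
    have hβ0 : β.degree ≠ 0 := fun h0 =>
      (Finset.mem_erase.1 hβ).1 ((Finsupp.degree_eq_zero_iff β).1 h0)
    have hloc : l2On (cube c r) (polyOp (hasse β Q) w) ≤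
        l2On Set.univ (polyOp (hasse β Q) (mulSchwartz φ w)) := by
      refine le_trans (le_of_eq (l2On_congr (measurableSet_cube c r) ?_))
        (l2On_mono (Set.subset_univ _) _)
      refine polyOp_eqOn (isOpen_cube c r) (fun x hx => ?_) _
      rw [mulSchwartz_apply, hφ1 x hx, one_mul]
    have hdom := l2On_univ_polyOp_le (P := hasse β Q) (R := Q)
      (a := C / (κ * t) ^ β.degree) (b := C * (κ * t) ^ s / (κ * t) ^ β.degree)
      (by positivity) (by positivity) (fun ξ => by
        have := hSE β hβS (κ * t) hκt ξ
        rw [div_mul_eq_mul_div, ← add_div, le_div_iff₀ (by positivity)]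
        linarith) (mulSchwartz φ w)
    have hp : κ * t ^ β.degree ≤ (κ * t) ^ β.degree := by
      rw [mul_pow]
      gcongr
      exact le_self_pow₀ hκ1 hβ0
    rw [div_mul_eq_mul_div, div_mul_eq_mul_div, ← add_div, le_div_iff₀ (by positivity)] at hdom
    calc κ * (t ^ β.degree * l2On (cube c r) (polyOp (hasse β Q) w))
        = κ * t ^ β.degree * l2On (cube c r) (polyOp (hasse β Q) w) := by ring
      _ ≤ (κ * t) ^ β.degree * l2On Set.univ (polyOp (hasse β Q) (mulSchwartz φ w)) := by
          have := l2On_nonneg (cube c r) (polyOp (hasse β Q) w)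
          gcongr
      _ ≤ C * l2On Set.univ (polyOp Q (mulSchwartz φ w)) +
          C * (κ * t) ^ s * l2On Set.univ (mulSchwartz φ w) := by linarith
      _ ≤ C * (E₁ + (8 * m) ^ m * G') + C * (κ * t) ^ s * E₂ := by gcongr
      _ = C * Y := by rw [hY]; ring
  have hG'0 : 0 ≤ G' := Finset.sum_nonneg fun β _ =>
    mul_nonneg (by positivity) (l2On_nonneg _ _)
  have hY0 : 0 ≤ Y := by positivity
  have hsum : κ * lowerTerms Q c w r t ≤ K * Y := by
    rw [lowerTerms, Finset.mul_sum]
    calc _ ≤ ∑ β ∈ S.erase 0, C * Y := Finset.sum_le_sum hterm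
      _ = (S.erase 0).card * (C * Y) := by rw [Finset.sum_const, nsmul_eq_mul]
      _ ≤ S.card * (C * Y) := by gcongr; exact Finset.erase_subset _ _
      _ = K * Y := by rw [hK]; ring
  have hsum' : lowerTerms Q c w r t ≤ K * Y / κ := by
    rw [le_div_iff₀ hκ0]; linarith
  refine hsum'.trans ?_
  have e1 : (κ * t) ^ s = κ ^ s * t ^ s := Real.mul_rpow hκ0.le ht0.le
  have hts : 0 ≤ t ^ s := by positivity
  have h5 : E₁ + (κ * t) ^ s * E₂ ≤ κ ^ s * (E₁ + t ^ s * E₂) := by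
    rw [e1]
    nlinarith
  calc K * Y / κ = K * (8 * m) ^ m / κ * G' + K * (E₁ + (κ * t) ^ s * E₂) / κ := by
        rw [hY]; ring
    _ ≤ K * (8 * m) ^ m / κ * G' + K * (E₁ + (κ * t) ^ s * E₂) := by
        gcongr
        exact div_le_self (by positivity) hκ1
    _ ≤ K * (8 * m) ^ m / κ * G' + K * (κ ^ s * (E₁ + t ^ s * E₂)) := by gcongr
    _ = _ := by ring

/-- The interior estimate for `Q(D)`, uniform in the scale `1 / t`. -/
lemma HypoellipticEstimate.exists_interior {Q : MvPolynomial (Fin n) ℂ} {d : ℝ}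
    (h : HypoellipticEstimate Q d) (hd : 1 ≤ d) (hQ : 1 ≤ Q.totalDegree) :
    ∃ C : ℝ, 1 ≤ C ∧ ∀ (c : EuclideanSpace ℝ (Fin n)) (w : Schwartz n) (r R t : ℝ), 0 ≤ r → 1 ≤ t →
      r + 2 / t ≤ R → ∀ β ∈ (taylorHom n Q).support,
      t ^ β.degree * l2On (cube c r) (polyOp (hasse β Q) w) ≤
        C * (l2On (cube c R) (polyOp Q w) + t ^ (d * Q.totalDegree) * l2On (cube c R) w) := by
  obtain ⟨C, hC, hSE⟩ := h.exists_hasse_le hd (taylorHom n Q).support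
  set S := (taylorHom n Q).support with hS
  set m := Q.totalDegree with hm
  set s := d * m with hs
  have hm1 : (1 : ℝ) ≤ m := by exact_mod_cast hQ
  have hs0 : 0 ≤ s := by positivity
  have h2s : (1 : ℝ) ≤ 2 ^ s := Real.one_le_rpow (by norm_num) hs0
  set K : ℝ := S.card * C with hK
  have hK0 : 0 ≤ K := by positivity
  -- Chosen so that the coefficient `K (8m)^m / κ` of the error meets the requirement `θ 2^s ≤ 1/2`.
  set κ : ℝ := 2 * 2 ^ s * (K * (8 * m) ^ m) + 1 with hκ
  have hκ1 : 1 ≤ κ := le_add_of_nonneg_left (by positivity)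
  have hκ0 : 0 < κ := by linarith
  have hκs : 1 ≤ κ ^ s := Real.one_le_rpow hκ1 hs0
  set B := K * κ ^ s with hB
  have hB0 : 0 ≤ B := by positivity
  have hθ : K * (8 * m) ^ m / κ * 2 ^ s ≤ 1 / 2 := by
    rw [div_mul_eq_mul_div, div_le_iff₀ hκ0, hκ]
    linarith
  refine ⟨max 1 (2 * B * 2 ^ s), le_max_left _ _, fun c w r R t hr ht hR β hβ => ?_⟩
  have ht0 : 0 < t := by linarith
  have hrR : r ≤ R := by
    have : 0 < 2 / t := by positivity
    linarith
  have hE₁0 : 0 ≤ l2On (cube c R) (polyOp Q w) := l2On_nonneg _ _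
  have hE₂0 : 0 ≤ l2On (cube c R) w := l2On_nonneg _ _
  have hts : 0 ≤ t ^ s := by positivity
  rcases eq_or_ne β 0 with rfl | hβ0
  · rw [map_zero, pow_zero, one_mul, MvPolynomial.hasse_zero]
    calc l2On (cube c r) (polyOp Q w) ≤ l2On (cube c R) (polyOp Q w) :=
          l2On_mono (cube_mono c hrR) _
      _ ≤ l2On (cube c R) (polyOp Q w) + t ^ s * l2On (cube c R) w :=
          le_add_of_nonneg_right (by positivity)
      _ ≤ _ := le_mul_of_one_le_left (by positivity) (le_max_left _ _)
  · have hsingle : t ^ β.degree * l2On (cube c r) (polyOp (hasse β Q) w) ≤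
        lowerTerms Q c w r t :=
      Finset.single_le_sum
        (f := fun β : Fin n →₀ ℕ => t ^ β.degree * l2On (cube c r) (polyOp (hasse β Q) w))
        (fun β _ => mul_nonneg (by positivity) (l2On_nonneg _ _))
        (Finset.mem_erase.2 ⟨hβ0, hβ⟩)
    have hit := le_of_scale_iteration (G := lowerTerms Q c w) (s := s)
      (θ := K * (8 * m) ^ m / κ) (B := B) (E₁ := l2On (cube c R) (polyOp Q w))
      (E₂ := l2On (cube c R) w) (R := R)
      (G₀ := ∑ β ∈ S.erase 0, l2On (cube c R) (polyOp (hasse β Q) w))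
      hs0 (by positivity) hθ hB0 hE₁0 hE₂0 (Finset.sum_nonneg fun _ _ => l2On_nonneg _ _)
      (fun r t hr ht hR => lowerTerms_step hQ hC hs0 hκ1 hSE c w hr ht hR)
      (fun r t ht => lowerTerms_le_double Q c w r ht)
      (fun r t hr ht => lowerTerms_le_rpow_mul Q c w hr ht (le_mul_of_one_le_left (by positivity) hd))
      hr ht hR
    refine hsingle.trans (hit.trans ?_)
    gcongr
    exact le_max_right _ _

/-! ### Words in the lower order operators and the derivative estimate -/

/-- Iterated interior estimates. -/
lemma l2On_hasse_prod_le {Q : MvPolynomial (Fin n) ℂ} {s C : ℝ} (hC : 1 ≤ C)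
    {c : EuclideanSpace ℝ (Fin n)} {R t : ℝ} (ht : 1 ≤ t)
    (hint : ∀ (w : Schwartz n) (r R : ℝ), 0 ≤ r →
      r + 2 / t ≤ R → ∀ β ∈ (taylorHom n Q).support,
      t ^ β.degree * l2On (cube c r) (polyOp (hasse β Q) w) ≤
        C * (l2On (cube c R) (polyOp Q w) + t ^ s * l2On (cube c R) w))
    (L : List (Fin n →₀ ℕ)) (hL : ∀ β ∈ L, β ∈ (taylorHom n Q).support) (w : Schwartz n)
    (b r : ℝ) (hr : 0 ≤ r) (hR : r + 2 / t * L.length ≤ R)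
    (hb : ∀ i ≤ L.length, (t ^ s) ^ (L.length - i) * l2On (cube c R) (polyOp (Q ^ i) w) ≤ b) :
    t ^ L.sum.degree * l2On (cube c r) (polyOp (L.map fun β => hasse β Q).prod w) ≤
      (2 * C) ^ L.length * b := by
  have ht0 : 0 < t := by linarith
  have hts : 0 < t ^ s := by positivity
  induction L generalizing w b r with
  | nil =>
    have := hb 0 le_rfl
    simp only [List.length_nil, Nat.sub_zero, pow_zero, one_mul, polyOp_one] at this
    simp only [List.sum_nil, map_zero, pow_zero, one_mul, List.map_nil, List.prod_nil, polyOp_one,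
      List.length_nil]
    refine le_trans (l2On_mono (cube_mono c ?_) _) this
    simpa using hR
  | cons β L ih =>
    have hβ := hL β List.mem_cons_self
    have hL' : ∀ β ∈ L, β ∈ (taylorHom n Q).support := fun γ hγ => hL γ (List.mem_cons_of_mem _ hγ)
    have hR' : r + 2 / t + 2 / t * L.length ≤ R := by
      rw [List.length_cons] at hR
      push_cast at hR
      linarith
    have hr' : 0 ≤ r + 2 / t := by positivity
    -- The two terms of the interior estimate lead to a shorter word: on `Q(D) w` the index `i`
    -- shifts by one with the same `b`, and on `w` one factor `t^s` is freed, whence `b / t^s`.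
    have h1 := ih hL' (polyOp Q w) b (r + 2 / t) hr' hR' (fun i hi => by
      have := hb (i + 1) (by simpa using hi)
      rw [List.length_cons, Nat.add_sub_add_right, pow_succ, polyOp_mul] at this
      exact this)
    have h2 := ih hL' w (b / t ^ s) (r + 2 / t) hr' hR' (fun i hi => by
      have := hb i (by rw [List.length_cons]; omega)
      rw [List.length_cons, Nat.sub_add_comm hi, pow_succ] at this
      rw [le_div_iff₀ hts]
      linarith)
    have h3 := hint (polyOp (L.map fun β => hasse β Q).prod w) r (r + 2 / t) hr le_rfl β hβ
    rw [← polyOp_mul Q, mul_comm Q, polyOp_mul] at h3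
    rw [List.sum_cons, map_add, List.map_cons, List.prod_cons, polyOp_mul, List.length_cons,
      pow_succ (2 * C)]
    have hp : 0 < t ^ L.sum.degree := by positivity
    calc t ^ (β.degree + L.sum.degree) * l2On (cube c r)
          (polyOp (hasse β Q) (polyOp (L.map fun β => hasse β Q).prod w))
        = t ^ L.sum.degree * (t ^ β.degree * l2On (cube c r)
          (polyOp (hasse β Q) (polyOp (L.map fun β => hasse β Q).prod w))) := by
          rw [pow_add]; ring
      _ ≤ t ^ L.sum.degree * (C * (l2On (cube c (r + 2 / t))
            (polyOp (L.map fun β => hasse β Q).prod (polyOp Q w)) +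
            t ^ s * l2On (cube c (r + 2 / t)) (polyOp (L.map fun β => hasse β Q).prod w))) := by
          gcongr
      _ = C * (t ^ L.sum.degree * l2On (cube c (r + 2 / t))
            (polyOp (L.map fun β => hasse β Q).prod (polyOp Q w))) +
          C * (t ^ s * (t ^ L.sum.degree * l2On (cube c (r + 2 / t))
            (polyOp (L.map fun β => hasse β Q).prod w))) := by ring
      _ ≤ C * ((2 * C) ^ L.length * b) + C * (t ^ s * ((2 * C) ^ L.length * (b / t ^ s))) := by
          gcongr
      _ = _ := by field_simp; ring

/-- Iterated Leibniz formula, as an estimate. -/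
lemma l2On_polyOp_pow_mulSchwartz_le {Q : MvPolynomial (Fin n) ℂ} (φ : Schwartz n) (X : ℝ) (j : ℕ)
    (B : Fin n →₀ ℕ) (w : Schwartz n)
    (h : ∀ L : List (Fin n →₀ ℕ), L.length = j → (∀ β ∈ L, β ∈ (taylorHom n Q).support) →
      l2On Set.univ (mulSchwartz (polyOp (MvPolynomial.monomial (L.sum + B) 1) φ)
        (polyOp (L.map fun β => hasse β Q).prod w)) ≤ X) :
    l2On Set.univ (polyOp (Q ^ j) (mulSchwartz (polyOp (MvPolynomial.monomial B 1) φ) w)) ≤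
      ((taylorHom n Q).support.card : ℝ) ^ j * X := by
  induction j generalizing B w with
  | zero =>
    have := h [] rfl (by simp)
    simpa [polyOp_one] using this
  | succ j ih =>
    rw [pow_succ, polyOp_mul, polyOp_mulSchwartz, map_sum]
    refine (l2On_sum_le _ _ _).trans ?_
    have hterm : ∀ β ∈ (taylorHom n Q).support,
        l2On Set.univ (polyOp (Q ^ j) (mulSchwartz (polyOp (MvPolynomial.monomial β 1)
          (polyOp (MvPolynomial.monomial B 1) φ)) (polyOp (hasse β Q) w))) ≤
          ((taylorHom n Q).support.card : ℝ) ^ j * X := by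
      intro β hβ
      rw [← polyOp_mul, MvPolynomial.monomial_mul, mul_one]
      -- All derivatives falling on `φ` are collected in `B`, so the same cutoff serves every step.
      refine ih (β + B) _ fun L hL hLS => ?_
      have := h (β :: L) (by rw [List.length_cons, hL]) (by
        intro γ hγ
        rcases List.mem_cons.1 hγ with rfl | hγ
        · exact hβ
        · exact hLS γ hγ)
      rw [List.sum_cons, List.map_cons, List.prod_cons, mul_comm, polyOp_mul] at this
      rwa [← add_assoc, add_comm L.sum β]
    refine (Finset.sum_le_sum hterm).trans (le_of_eq ?_)
    rw [Finset.sum_const, nsmul_eq_mul, pow_succ]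
    ring

lemma degree_list_sum_le {Q : MvPolynomial (Fin n) ℂ} (L : List (Fin n →₀ ℕ))
    (hL : ∀ β ∈ L, β ∈ (taylorHom n Q).support) :
    L.sum.degree ≤ L.length * Q.totalDegree := by
  induction L with
  | nil => simp
  | cons β L ih =>
    have h1 := degree_le_of_mem_support_taylorHom (hL β List.mem_cons_self)
    have h2 := ih fun γ hγ => hL γ (List.mem_cons_of_mem _ hγ)
    rw [List.sum_cons, map_add, List.length_cons]
    linarith [add_mul L.length 1 Q.totalDegree]

/-- Derivatives of order at most `l m / d` are controlled by `l` iterates of `Q(D)`. -/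
lemma HypoellipticEstimate.exists_derivative_le {Q : MvPolynomial (Fin n) ℂ} {d : ℝ}
    (h : HypoellipticEstimate Q d) (hd : 1 ≤ d) (hQ : 1 ≤ Q.totalDegree) :
    ∃ A : ℝ, 1 ≤ A ∧ ∀ (c : EuclideanSpace ℝ (Fin n)) (w : Schwartz n) (r κ b : ℝ) (l : ℕ),
      0 ≤ r → 1 ≤ κ → 1 ≤ l →
      (∀ i ≤ l, ((κ * l) ^ (d * Q.totalDegree)) ^ (l - i) *
        l2On (cube c (r + 3 / κ)) (polyOp (Q ^ i) w) ≤ b) →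
      ∀ α : Fin n →₀ ℕ, d * α.degree ≤ l * Q.totalDegree →
        l2On (cube c r) (polyOp (MvPolynomial.monomial α 1) w) ≤ A ^ l * b := by
  obtain ⟨C, hC, hint⟩ := h.exists_interior hd hQ
  obtain ⟨C₂, hC₂, hmon⟩ := h.exists_monomial_le hd hQ
  set S := (taylorHom n Q).support with hS
  set m := Q.totalDegree with hm
  have hm1 : (1 : ℝ) ≤ m := by exact_mod_cast hQ
  have hcard : (1 : ℝ) ≤ S.card := by
    exact_mod_cast Finset.card_pos.2 ⟨0, zero_mem_support_taylorHom hQ⟩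
  have h8m : (1 : ℝ) ≤ (8 * m) ^ m := one_le_pow₀ (by linarith)
  set A₁ : ℝ := S.card * ((8 * m) ^ m * (2 * C)) with hA₁
  have hA₁1 : 1 ≤ A₁ := one_le_mul_of_one_le_of_one_le hcard
    (one_le_mul_of_one_le_of_one_le h8m (by linarith))
  refine ⟨2 * C₂ * A₁, one_le_mul_of_one_le_of_one_le (by linarith) hA₁1,
    fun c w r κ b l hr hκ hl hb α hα => ?_⟩
  have hl1 : (1 : ℝ) ≤ l := by exact_mod_cast hl
  have hκ0 : 0 < κ := by linarith
  -- The `l` interior estimates enlarge the cube by `2 l / t = 2/κ`; together with the cutoff layer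
  -- `1/κ` this gives the radius `r + 3/κ`.
  set t := κ * l with ht
  have ht1 : 1 ≤ t := one_le_mul_of_one_le_of_one_le hκ hl1
  have ht0 : 0 < t := by linarith
  have hts : 1 ≤ t ^ (d * m) := Real.one_le_rpow ht1 (by positivity)
  have hk0 : 0 < 1 / κ := by positivity
  -- At most `l m` derivatives fall on `φ`, each costing `8 l m κ = 8 m t`; the powers of `t` are
  -- those paired with the words.
  obtain ⟨φ, hφ1, hφ⟩ := exists_cutoff c hr (δ := 1 / κ) hk0 (N := l * m) (Nat.mul_pos hl hQ)
  have hk3 : r + 1 / κ ≤ r + 3 / κ := by gcongr; norm_num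
  have hφw : l2On Set.univ (mulSchwartz φ w) ≤ b := by
    have h0 := hφ 0 (by simp)
    rw [show (MvPolynomial.monomial 0 1 : MvPolynomial (Fin n) ℂ) = 1 from rfl, polyOp_one,
      map_zero, pow_zero] at h0
    have h1 := l2On_mulSchwartz_le (measurableSet_cube _ _) zero_le_one h0.1 h0.2 w
    have h2 := hb 0 (Nat.zero_le _)
    rw [pow_zero, polyOp_one] at h2
    calc l2On Set.univ (mulSchwartz φ w) ≤ 1 * l2On (cube c (r + 1 / κ)) w := h1
      _ ≤ (t ^ (d * m)) ^ (l - 0) * l2On (cube c (r + 3 / κ)) w := by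
        gcongr
        · exact l2On_nonneg _ _
        · exact one_le_pow₀ hts
        · exact l2On_mono (cube_mono c hk3) w
      _ ≤ b := h2
  have hb0 : 0 ≤ b := (l2On_nonneg _ _).trans hφw
  have hQl : l2On Set.univ (polyOp (Q ^ l) (mulSchwartz φ w)) ≤ A₁ ^ l * b := by
    have h1 := l2On_polyOp_pow_mulSchwartz_le (Q := Q) φ (((8 * m) ^ m * (2 * C)) ^ l * b) l 0 w
      (fun L hL hLS => by
        have hdeg := degree_list_sum_le L hLS
        rw [hL] at hdeg
        rw [add_zero]
        have h2 := l2On_mulSchwartz_le (measurableSet_cube _ _) (by positivity)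
          (hφ L.sum hdeg).1 (hφ L.sum hdeg).2 (polyOp (L.map fun β => hasse β Q).prod w)
        have h3 := l2On_hasse_prod_le (R := r + 3 / κ) hC ht1 (fun w r R hr hR β hβ =>
          hint c w r R t hr ht1 hR β hβ) L hLS w b (r + 1 / κ) (by positivity) (by
            rw [hL, ht]
            refine le_of_eq ?_
            field_simp
            ring) (by rw [hL]; exact hb)
        rw [hL] at h3
        refine h2.trans ?_
        have e : 8 * ((l * m : ℕ) : ℝ) / (1 / κ) = 8 * m * t := by
          rw [ht]; push_cast; field_simp
        rw [e, mul_pow]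
        have hx := l2On_nonneg (cube c (r + 1 / κ)) (polyOp (L.map fun β => hasse β Q).prod w)
        calc (8 * (m : ℝ)) ^ L.sum.degree * t ^ L.sum.degree *
              l2On (cube c (r + 1 / κ)) (polyOp (L.map fun β => hasse β Q).prod w)
            ≤ (8 * (m : ℝ)) ^ (l * m) * (t ^ L.sum.degree *
              l2On (cube c (r + 1 / κ)) (polyOp (L.map fun β => hasse β Q).prod w)) := by
              rw [mul_assoc]
              gcongr
              linarith
          _ ≤ (8 * (m : ℝ)) ^ (l * m) * ((2 * C) ^ l * b) := by gcongr
          _ = _ := by rw [mul_comm l m, pow_mul, mul_pow]; ring)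
    rw [show (MvPolynomial.monomial 0 1 : MvPolynomial (Fin n) ℂ) = 1 from rfl, polyOp_one] at h1
    refine h1.trans (le_of_eq ?_)
    rw [hA₁, mul_pow (S.card : ℝ)]
    ring
  have hloc : l2On (cube c r) (polyOp (MvPolynomial.monomial α 1) w) ≤
      l2On Set.univ (polyOp (MvPolynomial.monomial α 1) (mulSchwartz φ w)) := by
    refine le_trans (le_of_eq (l2On_congr (measurableSet_cube c r) ?_))
      (l2On_mono (Set.subset_univ _) _)
    refine polyOp_eqOn (isOpen_cube c r) (fun x hx => ?_) _
    rw [mulSchwartz_apply, hφ1 x hx, one_mul]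
  have hdom := l2On_univ_polyOp_le (P := MvPolynomial.monomial α 1) (R := Q ^ l)
    (a := C₂ ^ l) (b := C₂ ^ l) (by positivity) (by positivity) (hmon α l hα) (mulSchwartz φ w)
  have h2l : (2 : ℝ) ≤ 2 ^ l := le_self_pow₀ (by norm_num) (by omega)
  have hA₁l : 1 ≤ A₁ ^ l := one_le_pow₀ hA₁1
  calc l2On (cube c r) (polyOp (MvPolynomial.monomial α 1) w)
      ≤ C₂ ^ l * l2On Set.univ (polyOp (Q ^ l) (mulSchwartz φ w)) +
        C₂ ^ l * l2On Set.univ (mulSchwartz φ w) := hloc.trans hdom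
    _ ≤ C₂ ^ l * (A₁ ^ l * b) + C₂ ^ l * b := by gcongr
    _ ≤ C₂ ^ l * (A₁ ^ l * b) + C₂ ^ l * (A₁ ^ l * b) := by
        gcongr; exact le_mul_of_one_le_left hb0 hA₁l
    _ = 2 * (C₂ ^ l * A₁ ^ l * b) := by ring
    _ ≤ 2 ^ l * (C₂ ^ l * A₁ ^ l * b) := by gcongr
    _ = _ := by rw [mul_pow (2 * C₂) A₁, mul_pow 2 C₂]; ring

end interior

/-! ### Localization and the choice of `l` -/

section localization

variable {n : ℕ}

lemma eLpNorm_two_restrict_union_le {α : Type*} [MeasurableSpace α] (μ : Measure α) (f : α → ℂ)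
    (s t : Set α) : eLpNorm f 2 (μ.restrict (s ∪ t)) ≤
      eLpNorm f 2 (μ.restrict s) + eLpNorm f 2 (μ.restrict t) := by
  simp only [eLpNorm_eq_lintegral_rpow_enorm_toReal (p := 2) (by norm_num) (by norm_num)]
  calc _ ≤ ((∫⁻ x in s, ‖f x‖ₑ ^ (2 : ENNReal).toReal ∂μ) +
        ∫⁻ x in t, ‖f x‖ₑ ^ (2 : ENNReal).toReal ∂μ) ^ (1 / (2 : ENNReal).toReal) := by
        gcongr
        exact lintegral_union_le _ _ _
    _ ≤ _ := ENNReal.rpow_add_le_add_rpow _ _ (by norm_num) (by norm_num)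

/-- A smooth function on an open set agrees near each point with a Schwartz function. -/
lemma exists_schwartz_eqOn {Ω : Set (EuclideanSpace ℝ (Fin n))} (hΩ : IsOpen Ω)
    {u : EuclideanSpace ℝ (Fin n) → ℂ} (hu : ContDiffOn ℝ ∞ u Ω) {c : EuclideanSpace ℝ (Fin n)}
    {ρ : ℝ} (hρ : 0 < ρ) (hc : cube c ρ ⊆ Ω) :
    ∃ w : Schwartz n, Set.EqOn u w (cube c (ρ / 2)) := by
  obtain ⟨φ, hφ1, hφ⟩ := exists_cutoff c (r := ρ / 2) (δ := ρ / 4) (by positivity) (by positivity)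
    le_rfl
  have hφ0 := (hφ 0 (by simp)).2
  rw [show (MvPolynomial.monomial 0 1 : MvPolynomial (Fin n) ℂ) = 1 from rfl, polyOp_one] at hφ0
  have hcs : HasCompactSupport fun x => φ x * u x := by
    refine HasCompactSupport.intro (isCompact_closedCube c (ρ / 2 + ρ / 4)) fun x hx => ?_
    rw [hφ0 x fun hx' => hx fun i => (hx' i).le, zero_mul]
  have hcd : ContDiff ℝ ∞ fun x => φ x * u x := by
    rw [contDiff_iff_contDiffAt]
    intro x
    -- Nothing is known about `u` outside `Ω`, but there the cutoff vanishes in a neighbourhood of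
    -- the point.
    by_cases hx : x ∈ Ω
    · exact (φ.smooth ⊤).contDiffAt.mul (hu.contDiffAt (hΩ.mem_nhds hx))
    · have hx' : x ∉ cube c ρ := fun h => hx (hc h)
      simp only [cube, Set.mem_ofPred_eq, not_forall, not_lt] at hx'
      obtain ⟨i, hi⟩ := hx'
      have hV : IsOpen {y : EuclideanSpace ℝ (Fin n) | ρ / 2 + ρ / 4 < |y i - c i|} :=
        isOpen_lt continuous_const (by fun_prop)
      have hxV : x ∈ {y : EuclideanSpace ℝ (Fin n) | ρ / 2 + ρ / 4 < |y i - c i|} :=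
        lt_of_lt_of_le (by linarith) hi
      refine (contDiffAt_const (c := (0 : ℂ))).congr_of_eventuallyEq
        (Filter.eventuallyEq_of_mem (hV.mem_nhds hxV) fun y hy => ?_)
      rw [hφ0 y fun hy' => absurd (hy' i) (not_lt.2 (le_of_lt hy)), zero_mul]
  refine ⟨hcs.toSchwartzMap hcd, fun x hx => ?_⟩
  change u x = φ x * u x
  rw [hφ1 x hx, one_mul]

lemma exists_local_bound {Ω : Set (EuclideanSpace ℝ (Fin n))} (hΩ : IsOpen Ω)
    {Q : MvPolynomial (Fin n) ℂ} (hQ : 1 ≤ Q.totalDegree) {d : ℝ} (hd : 1 ≤ d)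
    (hE : HypoellipticEstimate Q d) {M : ℕ → ℝ} (hMpos : ∀ p, 0 < M p) (hM1 : LogConvexSeq M)
    (hM2 : StableSeq M) (hdM : SeqSubordinate (fun p => (p.factorial : ℝ) ^ d) M)
    {u : EuclideanSpace ℝ (Fin n) → ℂ} (hu : u ∈ RoumieuVectors M Ω Q)
    {c : EuclideanSpace ℝ (Fin n)} (hcΩ : c ∈ Ω) :
    ∃ r : ℝ, 0 < r ∧ ∃ C : ℝ, 1 ≤ C ∧ ∀ α : Fin n →₀ ℕ,
      eLpNorm (multiD α u) 2 (volume.restrict (cube c r)) ≤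
        ENNReal.ofReal (C ^ (α.degree + 1) * M α.degree ^ d) := by
  obtain ⟨ρ, hρ, hcρ⟩ := exists_cube_subset hΩ hcΩ
  obtain ⟨w, hw⟩ := exists_schwartz_eqOn hΩ hu.1 hρ hcρ
  have hK : {x : EuclideanSpace ℝ (Fin n) | ∀ i, |x i - c i| ≤ ρ / 2} ⊆ Ω := fun x hx =>
    hcρ fun i => lt_of_le_of_lt (hx i) (by linarith)
  obtain ⟨C₀, hC₀, hC₀u⟩ := hu.2 _ (isCompact_closedCube c (ρ / 2)) hK
  obtain ⟨A, hA, hAest⟩ := hE.exists_derivative_le hd hQ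
  obtain ⟨A₁, hA₁, hseq₁⟩ := exists_rpow_mul_le hMpos hM2 (by linarith) hdM hQ
  obtain ⟨A₂, hA₂, hseq₂⟩ := exists_le_rpow_of_le hMpos hM1 hM2 (d := d) (by linarith) Q.totalDegree
  set m := Q.totalDegree with hm
  have hm1 : (1 : ℝ) ≤ m := by exact_mod_cast hQ
  set C₁ := max 1 C₀ with hC₁
  have hC₁1 : 1 ≤ C₁ := le_max_left _ _
  -- This keeps the enlarged cube, of half side `ρ/4 + 3/κ`, within the cube of half side `ρ/2` on
  -- which `u = w`.
  set κ := max 1 (12 / ρ) with hκ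
  have hκ1 : 1 ≤ κ := le_max_left _ _
  have hκ0 : 0 < κ := by linarith
  have hκρ : ρ / 4 + 3 / κ ≤ ρ / 2 := by
    have : 12 / ρ ≤ κ := le_max_right _ _
    rw [div_le_iff₀ hρ] at this
    have : 3 / κ ≤ ρ / 4 := by
      rw [div_le_iff₀ hκ0]
      linarith
    linarith
  set s := d * m with hs
  have hκs : 1 ≤ κ ^ s := Real.one_le_rpow hκ1 (by positivity)
  have hopen := isOpen_cube c (ρ / 2)
  have hiter : ∀ i, l2On (cube c (ρ / 4 + 3 / κ)) (polyOp (Q ^ i) w) ≤ C₁ ^ (i + 1) * M (i * m) := by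
    intro i
    refine (l2On_mono (cube_mono c hκρ) _).trans ?_
    have hMi := (hMpos (i * m)).le
    rw [← ENNReal.ofReal_le_ofReal_iff (by positivity), ofReal_l2On, ← constCoeffOp_iterate_coe,
      ← eLpNorm_congr_ae ((ae_restrict_iff' hopen.measurableSet).2
        (Filter.Eventually.of_forall (constCoeffOp_iterate_eqOn hopen hw Q i)))]
    calc _ ≤ eLpNorm ((constCoeffOp Q)^[i] u) 2 (volume.restrict
          {x : EuclideanSpace ℝ (Fin n) | ∀ i, |x i - c i| ≤ ρ / 2}) :=
          eLpNorm_mono_measure _ (Measure.restrict_mono (fun x hx i => (hx i).le) le_rfl)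
      _ ≤ ENNReal.ofReal (C₀ ^ (i + 1) * M (i * m)) := hC₀u i
      _ ≤ _ := by
        refine ENNReal.ofReal_le_ofReal ?_
        gcongr
        exact le_max_right _ _
  set D := A * κ ^ s * C₁ * A₁ with hD
  have hD1 : 1 ≤ D := one_le_mul_of_one_le_of_one_le (one_le_mul_of_one_le_of_one_le
    (one_le_mul_of_one_le_of_one_le hA hκs) hC₁1) hA₁
  have hmain : ∀ (α : Fin n →₀ ℕ) (l : ℕ), 1 ≤ l → d * α.degree ≤ l * m →
      l2On (cube c (ρ / 4)) (polyOp (MvPolynomial.monomial α 1) w) ≤ D ^ (l + 1) * M (l * m) := by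
    intro α l hl hα
    have hMl := (hMpos (l * m)).le
    refine (hAest c w (ρ / 4) κ ((κ ^ s) ^ l * (C₁ ^ (l + 1) * (A₁ ^ (l + 1) * M (l * m)))) l
      (by positivity) hκ1 hl (fun i hi => ?_) α hα).trans ?_
    · have hMi := (hMpos (i * m)).le
      have e : ((κ * (l : ℝ)) ^ s) ^ (l - i) = (κ ^ s) ^ (l - i) * ((l : ℝ) ^ s) ^ (l - i) := by
        rw [Real.mul_rpow hκ0.le (by positivity), mul_pow]
      calc ((κ * (l : ℝ)) ^ s) ^ (l - i) * l2On (cube c (ρ / 4 + 3 / κ)) (polyOp (Q ^ i) w)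
          ≤ ((κ ^ s) ^ (l - i) * ((l : ℝ) ^ s) ^ (l - i)) * (C₁ ^ (i + 1) * M (i * m)) := by
            rw [e]
            gcongr
            exact hiter i
        _ = (κ ^ s) ^ (l - i) * (C₁ ^ (i + 1) * (((l : ℝ) ^ s) ^ (l - i) * M (i * m))) := by ring
        _ ≤ (κ ^ s) ^ l * (C₁ ^ (l + 1) * (A₁ ^ (l + 1) * M (l * m))) := by
            have h1 := hseq₁ l i hi
            have h2 : (κ ^ s) ^ (l - i) ≤ (κ ^ s) ^ l := pow_le_pow_right₀ hκs (Nat.sub_le l i)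
            have h3 : C₁ ^ (i + 1) ≤ C₁ ^ (l + 1) := pow_le_pow_right₀ hC₁1 (by omega)
            gcongr
    · calc A ^ l * ((κ ^ s) ^ l * (C₁ ^ (l + 1) * (A₁ ^ (l + 1) * M (l * m))))
          ≤ A ^ (l + 1) * ((κ ^ s) ^ (l + 1) * (C₁ ^ (l + 1) * (A₁ ^ (l + 1) * M (l * m)))) := by
            have h1 : A ^ l ≤ A ^ (l + 1) := pow_le_pow_right₀ hA (by omega)
            have h2 : (κ ^ s) ^ l ≤ (κ ^ s) ^ (l + 1) := pow_le_pow_right₀ hκs (by omega)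
            gcongr
        _ = _ := by
            rw [hD, mul_pow (A * κ ^ s * C₁), mul_pow (A * κ ^ s), mul_pow A]
            ring
  refine ⟨ρ / 4, by positivity, D ^ (⌈d⌉₊ + 3) * A₂,
    one_le_mul_of_one_le_of_one_le (one_le_pow₀ hD1) hA₂, fun α => ?_⟩
  rw [eLpNorm_congr_ae ((ae_restrict_iff' (measurableSet_cube c (ρ / 4))).2
    (Filter.Eventually.of_forall fun x hx => multiD_eqOn hopen hw α
      (cube_mono c (by linarith : ρ / 4 ≤ ρ / 2) hx))), multiD_coe, ← ofReal_l2On]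
  refine ENNReal.ofReal_le_ofReal ?_
  set a := α.degree with ha
  -- The number of iterates will be `l = q + 1`, the extra one ensuring `l ≥ 1` when `α = 0`. Then
  -- `l m` lies between `d a` and `d a + 2 m`, the window of `exists_le_rpow_of_le`.
  set q := ⌈d * a / m⌉₊ with hq
  have hda : 0 ≤ d * a / m := by positivity
  have hq1 : d * a / m ≤ q := Nat.le_ceil _
  have hq2 : (q : ℝ) < d * a / m + 1 := Nat.ceil_lt_add_one hda
  rw [div_le_iff₀ (by positivity)] at hq1
  have hq3 : (q : ℝ) * m < d * a + m := by
    have h1 := mul_lt_mul_of_pos_right hq2 (by linarith : (0 : ℝ) < m)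
    have h2 : (d * a / m + 1) * m = d * a + m := by field_simp
    linarith
  have hqd : q ≤ ⌈d⌉₊ * a := by
    refine Nat.ceil_le.2 ?_
    rw [div_le_iff₀ (by positivity)]
    push_cast
    have h1 : d * a ≤ ⌈d⌉₊ * a := by gcongr; exact Nat.le_ceil d
    exact h1.trans (le_mul_of_one_le_right (by positivity) hm1)
  have h1 := hmain α (q + 1) (by omega) (by push_cast; linarith)
  have h2 := hseq₂ a ((q + 1) * m) (by push_cast; linarith) (by push_cast; linarith)
  have hMa : 0 ≤ M a ^ d := Real.rpow_nonneg (hMpos a).le _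
  calc _ ≤ D ^ (q + 1 + 1) * M ((q + 1) * m) := h1
    _ ≤ D ^ ((⌈d⌉₊ + 3) * (a + 1)) * (A₂ ^ (a + 1) * M a ^ d) := by
        refine mul_le_mul (pow_le_pow_right₀ hD1 ?_) h2 (hMpos _).le (by positivity)
        nlinarith
    _ = _ := by rw [pow_mul, mul_pow]; ring

end localization

theorem theorem1 {n : ℕ} (Ω : Set (EuclideanSpace ℝ (Fin n))) (hΩ : IsOpen Ω)
    (Q : MvPolynomial (Fin n) ℂ) (hQ : 1 ≤ Q.totalDegree)
    (d : ℝ) (hd : IsDHypoelliptic Q d)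
    (M : ℕ → ℝ) (hMpos : ∀ p, 0 < M p) (hM1 : LogConvexSeq M) (hM2 : StableSeq M)
    (hdM : SeqSubordinate (fun p => (p.factorial : ℝ) ^ d) M) :
    RoumieuVectors M Ω Q ⊆ RoumieuSpace (fun p => M p ^ d) Ω := by
  obtain ⟨⟨hd1, hE⟩, -⟩ := hd
  intro u hu
  refine ⟨hu.1, fun K hK hKΩ => ?_⟩
  have key : ∃ C : ℝ, 1 ≤ C ∧ ∀ α : Fin n →₀ ℕ, eLpNorm (multiD α u) 2 (volume.restrict K) ≤
      ENNReal.ofReal (C ^ (α.degree + 1) * M α.degree ^ d) := by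
    -- The property passes to subsets and finite unions, so the local bound suffices; for a union
    -- the constants add, because `C^p + C'^p ≤ (C + C')^p` for `p ≥ 1`.
    refine hK.induction_on (p := fun K => ∃ C : ℝ, 1 ≤ C ∧ ∀ α : Fin n →₀ ℕ,
      eLpNorm (multiD α u) 2 (volume.restrict K) ≤
        ENNReal.ofReal (C ^ (α.degree + 1) * M α.degree ^ d)) ?_ ?_ ?_ ?_
    · exact ⟨1, le_rfl, fun α => by simp⟩
    · rintro s t hst ⟨C, hC, h⟩
      exact ⟨C, hC, fun α =>
        (eLpNorm_mono_measure _ (Measure.restrict_mono hst le_rfl)).trans (h α)⟩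
    · rintro s t ⟨C, hC, h⟩ ⟨C', hC', h'⟩
      refine ⟨C + C', by linarith, fun α => (eLpNorm_two_restrict_union_le _ _ s t).trans
        ((add_le_add (h α) (h' α)).trans ?_)⟩
      have hMa : 0 ≤ M α.degree ^ d := Real.rpow_nonneg (hMpos _).le _
      rw [← ENNReal.ofReal_add (by positivity) (by positivity), ← add_mul]
      refine ENNReal.ofReal_le_ofReal (mul_le_mul_of_nonneg_right ?_ hMa)
      exact pow_add_pow_le (by linarith) (by linarith) (Nat.succ_ne_zero _)
    · intro x hx
      obtain ⟨r, hr, C, hC, h⟩ := exists_local_bound hΩ hQ hd1 hE hMpos hM1 hM2 hdM hu (hKΩ hx)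
      exact ⟨cube x r, mem_nhdsWithin_of_mem_nhds ((isOpen_cube x r).mem_nhds
        fun i => by simpa using hr), C, hC, h⟩
  obtain ⟨C, hC, h⟩ := key
  exact ⟨C, by linarith, h⟩
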